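/- Let $R$ be a nonzero commutative unital ring. Let $\mathscr C_R$ be the following category. Its objects are the pairs $(G,X)$, written $\frac XG$ or $X/G$, where $G$ is a finite group and $X$ is a finite $G$-set. For objects $X/G$ and $Y/H$, $$\mathrm{Hom}_{\mathscr C_R}\Big(\frac XG,\frac YH\Big)=R\otimes_{\mathbb Z}B^{H\times G}(Y\times X),$$ where $B^{H\times G}(Y\times X)$ is the Grothendieck group, with respect to disjoint union, of isomorphism classes of spans $Y\xleftarrow{\beta}U\xrightarrow{\alpha}X$ of finite $(H\times G)$-sets, the group $H\times G$ acting on $Y$ and on $X$ through its two projections. Composition is the bilinear extension of $$\langle V,\delta,\gamma\rangle\circ\langle U,\beta,\alpha\rangle=\langle V\hat\times_HU,\hat\delta,\hat\alpha\rangle,\qquad V\hat\times_HU=\{(v,u)\in V\times U\mid\gamma(v)=\beta(u)\}/H,$$ where $h\in H$ acts by $h\cdot(v,u)=((1,h)v,(h,1)u)$, $\hat\delta[v,u]=\delta(v)$ and $\hat\alpha[v,u]=\alpha(u)$. The identity of $X/G$ is the class of $G\times X$ with the action $(a,b)(g,x)=(agb^{-1},ax)$ and the maps $(g,x)\mapsto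 x$ (to the left) and $(g,x)\mapsto g^{-1}x$ (to the right). This is an additive category, with direct sum $$\frac XG\oplus\frac YH=\frac{(X\times H)\sqcup(G\times Y)}{G\times H}$$ and zero object $\emptyset/\{1\}$. Write $\{\bullet\}$ for the one-point set. 1. If $G_1,\dots,G_n$ and $H_1,\dots,H_m$ $(n,m\ge 0)$ are finite groups such that $$\bigoplus_{i=1}^n\frac{\{\bullet\}}{G_i}\;\cong\;\bigoplus_{j=1}^m\frac{\{\bullet\}}{H_j}\quad\text{in }\mathscr C_R,$$ then $n=m$ and there is a permutation $\sigma\in S_n$ such that $G_i\cong H_{\sigma(i)}$ as groups for every $i$. 2. Let $X/G$ be an object of $\mathscr C_R$, let $X=\bigsqcup_{i=1}^nO_i$ be the decomposition of $X$ into $G$-orbits, and let $G_i$ be the stabilizer of an element of $O_i$. Then $$\frac XG\;\cong\;\bigoplus_{i=1}^n\frac{\{\bullet\}}{G_i},$$ and this decomposition is unique up to isomorphism: if $X/G\cong\bigoplus_{j=1}^m\{\bullet\}/H_j$ for finite groups $H_1,\dots,H_m$, then $n=m$ and there is $\sigma\in S_n$ such that $G_i\cong H_{\sigma(i)}$ for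 every $i$. 3. For every finite group $G$ the object $\{\bullet\}/G$ is indecomposable in $\mathscr C_R$: it is nonzero, and if it is isomorphic to $A\oplus B$ then $A$ or $B$ is a zero object. So the decomposition in 2. is a decomposition into indecomposable objects. -/

import Mathlib

open CategoryTheory CategoryTheory.Limits
open scoped TensorProduct

universe u v

/-- An object `X / G` of the category `𝒞_R`: a finite group `G` together with a finite (left)
`G`-set `X`.  The ring `R` only serves to select the category. -/
structure FracObj (R : Type v) : Type (u + 1) where
  /-- the group `G`, the denominator -/
  grp : Type u
  /-- the `G`-set `X`, the numerator -/
  pts : Type u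
  [group : Group grp]
  [finite_grp : Finite grp]
  [action : MulAction grp pts]
  [finite_pts : Finite pts]

attribute [instance] FracObj.group FracObj.finite_grp FracObj.action FracObj.finite_pts

/-- A span `Y ← U → X` of finite `(H × G)`-sets, from `P = X / G` to `Q = Y / H`.  Here `H × G` acts
on `Y` and on `X` through its two projections, so equivariance of the legs reads
`β ((h, g) u) = h (β u)` and `α ((h, g) u) = g (α u)`. -/
structure BisetSpan {R : Type v} (P Q : FracObj.{u} R) : Type (u + 1) where
  carrier : Type u
  [action : MulAction (Q.grp × P.grp) carrier]
  [finite_carrier : Finite carrier]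
  /-- the map `β : U → Y` -/
  left : carrier → Q.pts
  /-- the map `α : U → X` -/
  right : carrier → P.pts
  left_smul : ∀ (a : Q.grp × P.grp) (u : carrier), left (a • u) = a.1 • left u
  right_smul : ∀ (a : Q.grp × P.grp) (u : carrier), right (a • u) = a.2 • right u

attribute [instance] BisetSpan.action BisetSpan.finite_carrier

namespace BisetSpan

variable {R : Type v} {P Q S T : FracObj.{u} R}

/-- Isomorphism of spans: an equivariant bijection which commutes with both legs. -/
def Equivalent (U V : BisetSpan P Q) : Prop :=
  ∃ e : U.carrier ≃ V.carrier, (∀ (a : Q.grp × P.grp) (u : U.carrier), e (a • u) = a • e u) ∧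
    (∀ u, V.left (e u) = U.left u) ∧ (∀ u, V.right (e u) = U.right u)

theorem Equivalent.refl (U : BisetSpan P Q) : Equivalent U U :=
  ⟨Equiv.refl _, fun _ _ => rfl, fun _ => rfl, fun _ => rfl⟩

theorem Equivalent.symm {U V : BisetSpan P Q} (h : Equivalent U V) : Equivalent V U := by
  obtain ⟨e, h1, h2, h3⟩ := h
  refine ⟨e.symm, fun a u => ?_, fun u => ?_, fun u => ?_⟩
  · rw [Equiv.symm_apply_eq, h1, Equiv.apply_symm_apply]
  · rw [← h2, Equiv.apply_symm_apply]
  · rw [← h3, Equiv.apply_symm_apply]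

theorem Equivalent.trans {U V W : BisetSpan P Q} (h : Equivalent U V) (h' : Equivalent V W) :
    Equivalent U W := by
  obtain ⟨e, h1, h2, h3⟩ := h
  obtain ⟨e', h1', h2', h3'⟩ := h'
  refine ⟨e.trans e', fun a u => ?_, fun u => ?_, fun u => ?_⟩
  · simp [h1, h1']
  · simp [h2, h2']
  · simp [h3, h3']

instance setoid (P Q : FracObj.{u} R) : Setoid (BisetSpan P Q) where
  r := Equivalent
  iseqv := ⟨Equivalent.refl, Equivalent.symm, Equivalent.trans⟩

/-- The disjoint union of two spans. -/
def disjUnion (U V : BisetSpan P Q) : BisetSpan P Q where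
  carrier := U.carrier ⊕ V.carrier
  left := Sum.elim U.left V.left
  right := Sum.elim U.right V.right
  left_smul := by rintro a (u | u) <;> simp [U.left_smul, V.left_smul]
  right_smul := by rintro a (u | u) <;> simp [U.right_smul, V.right_smul]

/-- The empty span. -/
def empty (P Q : FracObj.{u} R) : BisetSpan P Q where
  carrier := PEmpty
  action := { smul := fun _ => id, one_smul := fun _ => rfl, mul_smul := fun _ _ _ => rfl }
  left := PEmpty.elim
  right := PEmpty.elim
  left_smul := fun _ u => u.elim
  right_smul := fun _ u => u.elim

theorem equivalent_empty (U : BisetSpan P Q) (h : IsEmpty U.carrier) :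
    Equivalent U (empty P Q) :=
  ⟨⟨fun u => h.elim u, fun u => u.elim, fun u => h.elim u, fun u => u.elim⟩,
    fun _ u => h.elim u, fun u => h.elim u, fun u => h.elim u⟩

theorem disjUnion_congr {U U' V V' : BisetSpan P Q} (h : Equivalent U U') (h' : Equivalent V V') :
    Equivalent (disjUnion U V) (disjUnion U' V') := by
  obtain ⟨e, h1, h2, h3⟩ := h
  obtain ⟨e', h1', h2', h3'⟩ := h'
  refine ⟨Equiv.sumCongr e e', ?_, ?_, ?_⟩
  · rintro a (u | u)
    · exact congrArg Sum.inl (h1 a u)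
    · exact congrArg Sum.inr (h1' a u)
  · rintro (u | u)
    · exact h2 u
    · exact h2' u
  · rintro (u | u)
    · exact h3 u
    · exact h3' u

theorem disjUnion_comm (U V : BisetSpan P Q) : Equivalent (disjUnion U V) (disjUnion V U) := by
  refine ⟨Equiv.sumComm _ _, ?_, ?_, ?_⟩
  · rintro a (u | u) <;> rfl
  · rintro (u | u) <;> rfl
  · rintro (u | u) <;> rfl

theorem disjUnion_assoc (U V W : BisetSpan P Q) :
    Equivalent (disjUnion (disjUnion U V) W) (disjUnion U (disjUnion V W)) := by
  refine ⟨Equiv.sumAssoc _ _ _, ?_, ?_, ?_⟩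
  · rintro a ((u | u) | u) <;> rfl
  · rintro ((u | u) | u) <;> rfl
  · rintro ((u | u) | u) <;> rfl

theorem empty_disjUnion (U : BisetSpan P Q) : Equivalent (disjUnion (empty P Q) U) U := by
  refine ⟨⟨Sum.elim (fun u => PEmpty.elim u) id, Sum.inr, ?_, ?_⟩, ?_, ?_, ?_⟩
  · rintro (u | u)
    · exact u.elim
    · rfl
  · intro u
    rfl
  · rintro a (u | u)
    · exact u.elim
    · rfl
  · rintro (u | u)
    · exact u.elim
    · rfl
  · rintro (u | u)
    · exact u.elim
    · rfl

/-- The pullback `W = {(v, u) | γ v = β u}` of `V → Y ← U`. -/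
def Pullback (V : BisetSpan Q S) (U : BisetSpan P Q) : Type u :=
  {w : V.carrier × U.carrier // V.right w.1 = U.left w.2}

namespace Pullback

variable {V : BisetSpan Q S} {U : BisetSpan P Q}

@[ext] theorem ext {w w' : Pullback V U} (h1 : w.1.1 = w'.1.1) (h2 : w.1.2 = w'.1.2) : w = w' :=
  Subtype.ext (Prod.ext h1 h2)

instance : Finite (Pullback V U) := inferInstanceAs (Finite {w : V.carrier × U.carrier // _})

/-- The action of the middle group `H` on the pullback,
`h • (v, u) = (v h⁻¹, h u) = ((1, h) v, (h, 1) u)`. -/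
instance : MulAction Q.grp (Pullback V U) where
  smul h w := ⟨(((1, h) : S.grp × Q.grp) • w.1.1, ((h, 1) : Q.grp × P.grp) • w.1.2), by
    simp [V.right_smul, U.left_smul, w.2]⟩
  one_smul _ := Pullback.ext (one_smul (S.grp × Q.grp) _) (one_smul (Q.grp × P.grp) _)
  mul_smul h h' w := by
    apply Pullback.ext
    · change ((1, h * h') : S.grp × Q.grp) • w.1.1 =
        ((1, h) : S.grp × Q.grp) • ((1, h') : S.grp × Q.grp) • w.1.1
      rw [smul_smul, Prod.mk_mul_mk, one_mul]
    · change ((h * h', 1) : Q.grp × P.grp) • w.1.2 =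
        ((h, 1) : Q.grp × P.grp) • ((h', 1) : Q.grp × P.grp) • w.1.2
      rw [smul_smul, Prod.mk_mul_mk, one_mul]

theorem smul_fst (h : Q.grp) (w : Pullback V U) :
    (h • w).1.1 = ((1, h) : S.grp × Q.grp) • w.1.1 := rfl

theorem smul_snd (h : Q.grp) (w : Pullback V U) :
    (h • w).1.2 = ((h, 1) : Q.grp × P.grp) • w.1.2 := rfl

/-- The action of the outer groups `K × G` on the pullback, `(k, g) (v, u) = (k v, u g⁻¹)`. -/
def outer (a : S.grp × P.grp) (w : Pullback V U) : Pullback V U :=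
  ⟨(((a.1, 1) : S.grp × Q.grp) • w.1.1, ((1, a.2) : Q.grp × P.grp) • w.1.2), by
    simp [V.right_smul, U.left_smul, w.2]⟩

theorem outer_one (w : Pullback V U) : outer 1 w = w :=
  Pullback.ext (one_smul (S.grp × Q.grp) _) (one_smul (Q.grp × P.grp) _)

theorem outer_mul (a b : S.grp × P.grp) (w : Pullback V U) :
    outer (a * b) w = outer a (outer b w) := by
  apply Pullback.ext
  · change ((a.1 * b.1, 1) : S.grp × Q.grp) • w.1.1 =
      ((a.1, 1) : S.grp × Q.grp) • ((b.1, 1) : S.grp × Q.grp) • w.1.1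
    rw [smul_smul, Prod.mk_mul_mk, one_mul]
  · change ((1, a.2 * b.2) : Q.grp × P.grp) • w.1.2 =
      ((1, a.2) : Q.grp × P.grp) • ((1, b.2) : Q.grp × P.grp) • w.1.2
    rw [smul_smul, Prod.mk_mul_mk, one_mul]

theorem outer_smul (a : S.grp × P.grp) (h : Q.grp) (w : Pullback V U) :
    outer a (h • w) = h • outer a w := by
  apply Pullback.ext
  · change ((a.1, 1) : S.grp × Q.grp) • ((1, h) : S.grp × Q.grp) • w.1.1 =
      ((1, h) : S.grp × Q.grp) • ((a.1, 1) : S.grp × Q.grp) • w.1.1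
    simp [smul_smul]
  · change ((1, a.2) : Q.grp × P.grp) • ((h, 1) : Q.grp × P.grp) • w.1.2 =
      ((h, 1) : Q.grp × P.grp) • ((1, a.2) : Q.grp × P.grp) • w.1.2
    simp [smul_smul]

end Pullback

/-- The composite `V ×̂_H U`: the set of `H`-orbits on the pullback, with its `(K × G)`-action
`(k, g) [v, u] = [k v, u g⁻¹]` and the maps `[v, u] ↦ δ v` and `[v, u] ↦ α u`. -/
def comp (V : BisetSpan Q S) (U : BisetSpan P Q) : BisetSpan P S where
  carrier := MulAction.orbitRel.Quotient Q.grp (Pullback V U)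
  action :=
    { smul := fun a => Quotient.map (Pullback.outer a) (by
        rintro w w' ⟨h, rfl⟩
        exact ⟨h, (Pullback.outer_smul a h w').symm⟩)
      one_smul := by
        rintro ⟨w⟩
        exact congrArg (Quotient.mk _) (Pullback.outer_one w)
      mul_smul := by
        rintro a b ⟨w⟩
        exact congrArg (Quotient.mk _) (Pullback.outer_mul a b w) }
  finite_carrier := Quotient.finite _
  left := Quotient.lift (fun w => V.left w.1.1) (by
    rintro w w' ⟨h, rfl⟩
    simp [Pullback.smul_fst, V.left_smul])
  right := Quotient.lift (fun w => U.right w.1.2) (by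
    rintro w w' ⟨h, rfl⟩
    simp [Pullback.smul_snd, U.right_smul])
  left_smul := by
    rintro a ⟨w⟩
    exact V.left_smul _ _
  right_smul := by
    rintro a ⟨w⟩
    exact U.right_smul _ _

/-- A criterion for recognizing a composite. -/
theorem comp_equivalent {V : BisetSpan Q S} {U : BisetSpan P Q} {Z : BisetSpan P S}
    (φ : Pullback V U → Z.carrier) (ψ : Z.carrier → Pullback V U)
    (hinv : ∀ (h : Q.grp) w, φ (h • w) = φ w) (h1 : ∀ z, φ (ψ z) = z)
    (h2 : ∀ w, ∃ h : Q.grp, h • w = ψ (φ w))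
    (hequi : ∀ a w, φ (Pullback.outer a w) = a • φ w)
    (hl : ∀ w, Z.left (φ w) = V.left w.1.1) (hr : ∀ w, Z.right (φ w) = U.right w.1.2) :
    Equivalent (comp V U) Z := by
  refine ⟨⟨Quotient.lift φ ?_, fun z => Quotient.mk _ (ψ z), ?_, h1⟩, ?_, ?_, ?_⟩
  · rintro w w' ⟨h, rfl⟩
    exact hinv h w'
  · rintro ⟨w⟩
    obtain ⟨h, hh⟩ := h2 w
    exact Quotient.sound (show _ ∈ MulAction.orbit _ _ from ⟨h, hh⟩)
  · rintro a ⟨w⟩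
    exact hequi a w
  · rintro ⟨w⟩
    exact hl w
  · rintro ⟨w⟩
    exact hr w

theorem comp_congr {V V' : BisetSpan Q S} {U U' : BisetSpan P Q} (h : Equivalent V V')
    (h' : Equivalent U U') : Equivalent (comp V U) (comp V' U') := by
  obtain ⟨e, h1, h2, h3⟩ := h
  obtain ⟨f, k1, k2, k3⟩ := h'
  have h1' : ∀ a u, e.symm (a • u) = a • e.symm u := fun a u => by
    rw [Equiv.symm_apply_eq, h1, Equiv.apply_symm_apply]
  have k1' : ∀ a u, f.symm (a • u) = a • f.symm u := fun a u => by
    rw [Equiv.symm_apply_eq, k1, Equiv.apply_symm_apply]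
  let F : Pullback V U → Pullback V' U' := fun w =>
    ⟨(e w.1.1, f w.1.2), by simpa [h3, k2] using w.2⟩
  let F' : Pullback V' U' → Pullback V U := fun w =>
    ⟨(e.symm w.1.1, f.symm w.1.2), by simpa [← h3, ← k2] using w.2⟩
  have hF : ∀ (h : Q.grp) w, F (h • w) = h • F w := fun h w =>
    Pullback.ext (h1 _ _) (k1 _ _)
  have hF' : ∀ (h : Q.grp) w, F' (h • w) = h • F' w := fun h w =>
    Pullback.ext (h1' _ _) (k1' _ _)
  refine comp_equivalent (fun w => Quotient.mk _ (F w)) (fun z => F' (Quotient.out z)) ?_ ?_ ?_ ?_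
    ?_ ?_
  · intro h w
    exact Quotient.sound (show _ ∈ MulAction.orbit _ _ from ⟨h, (hF h w).symm⟩)
  · intro z
    have : F (F' (Quotient.out z)) = Quotient.out z := by
      apply Pullback.ext <;> simp [F, F']
    simp only [this]
    exact Quotient.out_eq z
  · intro w
    have : (Quotient.out (Quotient.mk (MulAction.orbitRel Q.grp (Pullback V' U')) (F w))) ∈
        MulAction.orbit Q.grp (F w) := Quotient.mk_out (s := MulAction.orbitRel _ _) (F w)
    obtain ⟨h, hh⟩ := this
    refine ⟨h, ?_⟩
    have hh : h • F w = _ := hh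
    rw [← hh, hF']
    congr 1
    apply Pullback.ext <;> simp [F, F']
  · intro a w
    exact congrArg (Quotient.mk _) (Pullback.ext (h1 _ _) (k1 _ _))
  · intro w
    exact h2 _
  · intro w
    exact k3 _

theorem disjUnion_comp (V V' : BisetSpan Q S) (U : BisetSpan P Q) :
    Equivalent (comp (disjUnion V V') U) (disjUnion (comp V U) (comp V' U)) := by
  let φ : Pullback (disjUnion V V') U → (disjUnion (comp V U) (comp V' U)).carrier := fun w =>
    match w with
    | ⟨(Sum.inl v, u), h⟩ => Sum.inl (Quotient.mk _ ⟨(v, u), h⟩)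
    | ⟨(Sum.inr v, u), h⟩ => Sum.inr (Quotient.mk _ ⟨(v, u), h⟩)
  let i1 : Pullback V U → Pullback (disjUnion V V') U := fun w => ⟨(Sum.inl w.1.1, w.1.2), w.2⟩
  let i2 : Pullback V' U → Pullback (disjUnion V V') U := fun w => ⟨(Sum.inr w.1.1, w.1.2), w.2⟩
  refine comp_equivalent φ
    (Sum.elim (fun z => i1 (Quotient.out z)) (fun z => i2 (Quotient.out z))) ?_ ?_ ?_ ?_ ?_ ?_
  · rintro h ⟨⟨v | v, u⟩, hw⟩
    · exact congrArg Sum.inl (Quotient.sound (show _ ∈ MulAction.orbit _ _ from ⟨h, rfl⟩))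
    · exact congrArg Sum.inr (Quotient.sound (show _ ∈ MulAction.orbit _ _ from ⟨h, rfl⟩))
  · rintro (z | z)
    · exact congrArg Sum.inl (Quotient.out_eq z)
    · exact congrArg Sum.inr (Quotient.out_eq z)
  · rintro ⟨⟨v | v, u⟩, hw⟩
    · obtain ⟨h, hh⟩ := Quotient.mk_out (s := MulAction.orbitRel Q.grp (Pullback V U)) ⟨(v, u), hw⟩
      exact ⟨h, congrArg i1 hh⟩
    · obtain ⟨h, hh⟩ := Quotient.mk_out (s := MulAction.orbitRel Q.grp (Pullback V' U)) ⟨(v, u), hw⟩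
      exact ⟨h, congrArg i2 hh⟩
  · rintro a ⟨⟨v | v, u⟩, hw⟩ <;> rfl
  · rintro ⟨⟨v | v, u⟩, hw⟩ <;> rfl
  · rintro ⟨⟨v | v, u⟩, hw⟩ <;> rfl

theorem comp_disjUnion (V : BisetSpan Q S) (U U' : BisetSpan P Q) :
    Equivalent (comp V (disjUnion U U')) (disjUnion (comp V U) (comp V U')) := by
  let φ : Pullback V (disjUnion U U') → (disjUnion (comp V U) (comp V U')).carrier := fun w =>
    match w with
    | ⟨(v, Sum.inl u), h⟩ => Sum.inl (Quotient.mk _ ⟨(v, u), h⟩)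
    | ⟨(v, Sum.inr u), h⟩ => Sum.inr (Quotient.mk _ ⟨(v, u), h⟩)
  let i1 : Pullback V U → Pullback V (disjUnion U U') := fun w => ⟨(w.1.1, Sum.inl w.1.2), w.2⟩
  let i2 : Pullback V U' → Pullback V (disjUnion U U') := fun w => ⟨(w.1.1, Sum.inr w.1.2), w.2⟩
  refine comp_equivalent φ
    (Sum.elim (fun z => i1 (Quotient.out z)) (fun z => i2 (Quotient.out z))) ?_ ?_ ?_ ?_ ?_ ?_
  · rintro h ⟨⟨v, u | u⟩, hw⟩
    · exact congrArg Sum.inl (Quotient.sound (show _ ∈ MulAction.orbit _ _ from ⟨h, rfl⟩))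
    · exact congrArg Sum.inr (Quotient.sound (show _ ∈ MulAction.orbit _ _ from ⟨h, rfl⟩))
  · rintro (z | z)
    · exact congrArg Sum.inl (Quotient.out_eq z)
    · exact congrArg Sum.inr (Quotient.out_eq z)
  · rintro ⟨⟨v, u | u⟩, hw⟩
    · obtain ⟨h, hh⟩ := Quotient.mk_out (s := MulAction.orbitRel Q.grp (Pullback V U)) ⟨(v, u), hw⟩
      exact ⟨h, congrArg i1 hh⟩
    · obtain ⟨h, hh⟩ := Quotient.mk_out (s := MulAction.orbitRel Q.grp (Pullback V U')) ⟨(v, u), hw⟩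
      exact ⟨h, congrArg i2 hh⟩
  · rintro a ⟨⟨v, u | u⟩, hw⟩ <;> rfl
  · rintro ⟨⟨v, u | u⟩, hw⟩ <;> rfl
  · rintro ⟨⟨v, u | u⟩, hw⟩ <;> rfl

theorem comp_assoc (W : BisetSpan S T) (V : BisetSpan Q S) (U : BisetSpan P Q) :
    Equivalent (comp (comp W V) U) (comp W (comp V U)) := by
  -- every element on the left is the class of a triple
  let A : Pullback (comp W V) U → (comp W (comp V U)).carrier := fun z =>
    Quotient.hrecOn (motive := fun q : (comp W V).carrier => (comp W V).right q = U.left z.1.2 →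
        (comp W (comp V U)).carrier) z.1.1
      (fun w h => Quotient.mk _ ⟨(w.1.1, Quotient.mk _ ⟨(w.1.2, z.1.2), h⟩), w.2⟩)
      (by
        rintro w w' ⟨k, rfl⟩
        refine Function.hfunext (congrArg (fun q => (comp W V).right q = U.left z.1.2)
          (Quotient.sound (show _ ∈ MulAction.orbit _ _ from ⟨k, rfl⟩))) ?_
        intro h h' _
        refine heq_of_eq (Quotient.sound (show _ ∈ MulAction.orbit _ _ from ⟨k, ?_⟩))
        refine Pullback.ext rfl ?_
        refine congrArg (Quotient.mk _) (Pullback.ext rfl ?_)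
        exact one_smul (Q.grp × P.grp) _) z.2
  let B : Pullback W (comp V U) → Pullback (comp W V) U := fun z =>
    ⟨(Quotient.mk _ ⟨(z.1.1, (Quotient.out z.1.2).1.1), by
      have := z.2
      rw [this]
      conv_lhs => rw [← Quotient.out_eq z.1.2]
      rfl⟩, (Quotient.out z.1.2).1.2), (Quotient.out z.1.2).2⟩
  refine comp_equivalent A (fun z => B (Quotient.out z)) ?_ ?_ ?_ ?_ ?_ ?_
  · rintro h ⟨⟨⟨w⟩, u⟩, hw⟩
    refine congrArg (Quotient.mk _) (Pullback.ext ?_ ?_)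
    · exact one_smul (T.grp × S.grp) _
    · exact Quotient.sound (show _ ∈ MulAction.orbit _ _ from ⟨h, rfl⟩)
  · intro z
    conv_rhs => rw [← Quotient.out_eq z]
    refine congrArg (Quotient.mk _) (Pullback.ext rfl ?_)
    exact Quotient.out_eq (Quotient.out z).1.2
  · rintro ⟨⟨⟨w⟩, u⟩, hw⟩
    let p : Pullback W (comp V U) := ⟨(w.1.1, Quotient.mk _ ⟨(w.1.2, u), hw⟩), w.2⟩
    obtain ⟨k, hk⟩ := Quotient.mk_out (s := MulAction.orbitRel S.grp (Pullback W (comp V U))) p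
    have hk : k • p = Quotient.out (Quotient.mk _ p) := hk
    change ∃ h : Q.grp, h • _ = B (Quotient.out (Quotient.mk _ p))
    rw [← hk]
    let q : Pullback V U := Pullback.outer (k, 1) ⟨(w.1.2, u), hw⟩
    obtain ⟨h, hh⟩ := Quotient.mk_out (s := MulAction.orbitRel Q.grp (Pullback V U)) q
    have hh : h • q = Quotient.out (Quotient.mk _ q) := hh
    refine ⟨h, Pullback.ext ?_ ?_⟩
    · refine Quotient.sound (show _ ∈ MulAction.orbit _ _ from ⟨k⁻¹, ?_⟩)
      refine inv_smul_eq_iff.mpr (Pullback.ext ?_ ?_)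
      · change ((1, k) : T.grp × S.grp) • w.1.1 = ((1, k) : T.grp × S.grp) • _ 
        exact congrArg _ (one_smul (T.grp × S.grp) _).symm
      · change (Quotient.out (Quotient.mk _ q)).1.1 = _
        rw [← hh]
        change ((1, h) : S.grp × Q.grp) • ((k, 1) : S.grp × Q.grp) • w.1.2 =
          ((k, 1) : S.grp × Q.grp) • ((1, h) : S.grp × Q.grp) • w.1.2
        simp [smul_smul]
    · change ((h, 1) : Q.grp × P.grp) • u = (Quotient.out (Quotient.mk _ q)).1.2
      rw [← hh]
      change ((h, 1) : Q.grp × P.grp) • u = ((h, 1) : Q.grp × P.grp) • (1 : Q.grp × P.grp) • u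
      rw [one_smul]
  · rintro a ⟨⟨⟨w⟩, u⟩, hw⟩
    refine congrArg (Quotient.mk _) (Pullback.ext rfl ?_)
    refine congrArg (Quotient.mk _) (Pullback.ext ?_ rfl)
    rfl
  · rintro ⟨⟨⟨w⟩, u⟩, hw⟩
    rfl
  · rintro ⟨⟨⟨w⟩, u⟩, hw⟩
    rfl

/-- The identity span of `X / G`: the set `G × X` with `(a, b) (g, x) = (a g b⁻¹, a x)` and the maps
`(g, x) ↦ x` and `(g, x) ↦ g⁻¹ x`. -/
def idSpan (P : FracObj.{u} R) : BisetSpan P P where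
  carrier := P.grp × P.pts
  action :=
    { smul := fun a z => (a.1 * z.1 * a.2⁻¹, a.1 • z.2)
      one_smul := fun z => Prod.ext (by change 1 * z.1 * 1⁻¹ = z.1; simp) (one_smul P.grp z.2)
      mul_smul := fun a b z => Prod.ext
        (by
          change (a.1 * b.1) * z.1 * (a.2 * b.2)⁻¹ = a.1 * (b.1 * z.1 * b.2⁻¹) * a.2⁻¹
          group)
        (mul_smul a.1 b.1 z.2) }
  left := fun z => z.2
  right := fun z => z.1⁻¹ • z.2
  left_smul := fun _ _ => rfl
  right_smul := fun a z => by
    change (a.1 * z.1 * a.2⁻¹)⁻¹ • a.1 • z.2 = a.2 • z.1⁻¹ • z.2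
    simp [smul_smul, mul_assoc]

theorem comp_idSpan (U : BisetSpan P Q) : Equivalent (comp U (idSpan P)) U := by
  refine comp_equivalent (fun w => ((1, w.1.2.1⁻¹) : Q.grp × P.grp) • w.1.1)
    (fun u => ⟨(u, (1, U.right u)), rfl⟩) ?_ ?_ ?_ ?_ ?_ ?_
  · rintro h ⟨⟨u, g, x⟩, hw⟩
    change ((1, (h * g * 1⁻¹)⁻¹) : Q.grp × P.grp) • ((1, h) : Q.grp × P.grp) • u = _
    simp [smul_smul]
  · intro u
    change ((1, 1⁻¹) : Q.grp × P.grp) • u = u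
    rw [inv_one]
    exact one_smul (Q.grp × P.grp) u
  · rintro ⟨⟨u, g, x⟩, hw⟩
    have hw : U.right u = x := hw
    refine ⟨g⁻¹, Pullback.ext rfl (Prod.ext ?_ ?_)⟩
    · change g⁻¹ * g * 1⁻¹ = 1
      simp
    · change g⁻¹ • x = U.right (((1, g⁻¹) : Q.grp × P.grp) • u)
      rw [U.right_smul, hw]
  · rintro a ⟨⟨u, g, x⟩, hw⟩
    change ((1, (1 * g * a.2⁻¹)⁻¹) : Q.grp × P.grp) • ((a.1, 1) : Q.grp × P.grp) • u =
      a • ((1, g⁻¹) : Q.grp × P.grp) • u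
    simp only [smul_smul]
    congr 1
    ext <;> simp
  · rintro ⟨⟨u, g, x⟩, hw⟩
    change U.left (((1, g⁻¹) : Q.grp × P.grp) • u) = U.left u
    simp [U.left_smul]
  · rintro ⟨⟨u, g, x⟩, hw⟩
    have hw : U.right u = x := hw
    change U.right (((1, g⁻¹) : Q.grp × P.grp) • u) = g⁻¹ • x
    simp [U.right_smul, hw]

theorem idSpan_comp (U : BisetSpan P Q) : Equivalent (comp (idSpan Q) U) U := by
  refine comp_equivalent (fun w => ((w.1.1.1, 1) : Q.grp × P.grp) • w.1.2)
    (fun u => ⟨((1, U.left u), u), by change (1 : Q.grp)⁻¹ • U.left u = _; simp⟩) ?_ ?_ ?_ ?_ ?_ ?_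
  · rintro h ⟨⟨⟨g, x⟩, u⟩, hw⟩
    change ((1 * g * h⁻¹, 1) : Q.grp × P.grp) • ((h, 1) : Q.grp × P.grp) • u = _
    simp [smul_smul]
  · intro u
    exact one_smul (Q.grp × P.grp) u
  · rintro ⟨⟨⟨g, x⟩, u⟩, hw⟩
    have hw : g⁻¹ • x = U.left u := hw
    refine ⟨g, Pullback.ext (Prod.ext ?_ ?_) rfl⟩
    · change 1 * g * g⁻¹ = 1
      simp
    · change (1 : Q.grp) • x = U.left (((g, 1) : Q.grp × P.grp) • u)
      rw [U.left_smul, ← hw]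
      simp
  · rintro a ⟨⟨⟨g, x⟩, u⟩, hw⟩
    change ((a.1 * g * 1⁻¹, 1) : Q.grp × P.grp) • ((1, a.2) : Q.grp × P.grp) • u =
      a • ((g, 1) : Q.grp × P.grp) • u
    simp only [smul_smul]
    congr 1
    ext <;> simp
  · rintro ⟨⟨⟨g, x⟩, u⟩, hw⟩
    have hw : g⁻¹ • x = U.left u := hw
    change U.left (((g, 1) : Q.grp × P.grp) • u) = x
    simp [U.left_smul, ← hw]
  · rintro ⟨⟨⟨g, x⟩, u⟩, hw⟩
    change U.right (((g, 1) : Q.grp × P.grp) • u) = U.right u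
    simp [U.right_smul]

end BisetSpan

/-- Isomorphism classes of spans from `P` to `Q`. -/
def SpanClass {R : Type v} (P Q : FracObj.{u} R) : Type (u + 1) :=
  Quotient (BisetSpan.setoid P Q)

namespace SpanClass

variable {R : Type v} {P Q S T : FracObj.{u} R}

/-- Addition of isomorphism classes is given by disjoint union. -/
instance : Add (SpanClass P Q) :=
  ⟨Quotient.map₂ BisetSpan.disjUnion (fun _ _ h _ _ h' => BisetSpan.disjUnion_congr h h')⟩

instance : Zero (SpanClass P Q) := ⟨Quotient.mk _ (BisetSpan.empty P Q)⟩

instance : AddCommMonoid (SpanClass P Q) where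
  add_assoc := by
    rintro ⟨U⟩ ⟨V⟩ ⟨W⟩
    exact Quotient.sound (BisetSpan.disjUnion_assoc U V W)
  zero_add := by
    rintro ⟨U⟩
    exact Quotient.sound (BisetSpan.empty_disjUnion U)
  add_zero := by
    rintro ⟨U⟩
    exact Quotient.sound ((BisetSpan.disjUnion_comm _ _).trans (BisetSpan.empty_disjUnion U))
  add_comm := by
    rintro ⟨U⟩ ⟨V⟩
    exact Quotient.sound (BisetSpan.disjUnion_comm U V)
  nsmul := nsmulRec

/-- The class of a span. -/
def mk (U : BisetSpan P Q) : SpanClass P Q := Quotient.mk _ U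

theorem mk_add (U V : BisetSpan P Q) : mk U + mk V = mk (BisetSpan.disjUnion U V) := rfl

theorem mk_eq {U V : BisetSpan P Q} (h : BisetSpan.Equivalent U V) : mk U = mk V :=
  Quotient.sound h

theorem mk_eq_zero {U : BisetSpan P Q} (h : IsEmpty U.carrier) : mk U = 0 :=
  Quotient.sound (BisetSpan.equivalent_empty U h)

/-- Composition of isomorphism classes of spans. -/
def comp : SpanClass Q S →+ SpanClass P Q →+ SpanClass P S where
  toFun V :=
    { toFun := fun U => Quotient.map₂ BisetSpan.comp
        (fun _ _ h _ _ h' => BisetSpan.comp_congr h h') V U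
      map_zero' := by
        obtain ⟨V⟩ := V
        refine mk_eq_zero ⟨?_⟩
        rintro ⟨w⟩
        exact PEmpty.elim w.1.2
      map_add' := by
        obtain ⟨V⟩ := V
        rintro ⟨U⟩ ⟨U'⟩
        exact Quotient.sound (BisetSpan.comp_disjUnion V U U') }
  map_zero' := by
    ext ⟨U⟩
    refine mk_eq_zero ⟨?_⟩
    rintro ⟨w⟩
    exact PEmpty.elim w.1.1
  map_add' := by
    rintro ⟨V⟩ ⟨V'⟩
    ext ⟨U⟩
    exact Quotient.sound (BisetSpan.disjUnion_comp V V' U)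

theorem comp_mk (V : BisetSpan Q S) (U : BisetSpan P Q) :
    comp (mk V) (mk U) = mk (BisetSpan.comp V U) := rfl

end SpanClass

/-- The Burnside group `B^{H × G}(Y × X)`: the Grothendieck group of the commutative monoid of
isomorphism classes of finite `(H × G)`-sets over `Y × X`. -/
def BurnsideGroup {R : Type v} (P Q : FracObj.{u} R) : Type (u + 1) :=
  Algebra.GrothendieckAddGroup (SpanClass P Q)

namespace BurnsideGroup

variable {R : Type v} {P Q S T : FracObj.{u} R}

noncomputable instance : AddCommGroup (BurnsideGroup P Q) :=
  inferInstanceAs (AddCommGroup (Algebra.GrothendieckAddGroup (SpanClass P Q)))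

/-- The canonical map from isomorphism classes of spans to the Burnside group. -/
noncomputable def of : SpanClass P Q →+ BurnsideGroup P Q :=
  (Algebra.GrothendieckAddGroup.of : SpanClass P Q →+ Algebra.GrothendieckAddGroup _)

/-- The universal property of the Grothendieck group. -/
noncomputable def lift {A : Type*} [AddCommGroup A] (f : SpanClass P Q →+ A) :
    BurnsideGroup P Q →+ A :=
  Algebra.GrothendieckAddGroup.lift f

/-- The class of a span in the Burnside group. -/
noncomputable def mk (U : BisetSpan P Q) : BurnsideGroup P Q := of (SpanClass.mk U)

theorem lift_mk {A : Type*} [AddCommGroup A] (f : SpanClass P Q →+ A) (U : BisetSpan P Q) :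
    lift f (mk U) = f (SpanClass.mk U) :=
  DFunLike.congr_fun (Algebra.GrothendieckAddGroup.lift.symm_apply_apply f) (SpanClass.mk U)

/-- Additive maps out of the Burnside group are determined by their values on spans. -/
theorem hom_ext {A : Type*} [AddCommGroup A] {f g : BurnsideGroup P Q →+ A}
    (h : ∀ U, f (mk U) = g (mk U)) : f = g := by
  apply Algebra.GrothendieckAddGroup.lift.symm.injective
  ext ⟨U⟩
  exact h U

theorem mk_eq {U V : BisetSpan P Q} (h : BisetSpan.Equivalent U V) : mk U = mk V := by
  rw [mk, mk, SpanClass.mk_eq h]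

theorem mk_disjUnion (U V : BisetSpan P Q) :
    mk (BisetSpan.disjUnion U V) = mk U + mk V := by
  rw [mk, mk, mk, ← SpanClass.mk_add, map_add]

theorem mk_eq_zero {U : BisetSpan P Q} (h : IsEmpty U.carrier) : mk U = 0 := by
  rw [mk, SpanClass.mk_eq_zero h, map_zero]

/-- The biadditive extension of the composition of spans to Burnside groups. -/
noncomputable def comp : BurnsideGroup Q S →+ BurnsideGroup P Q →+ BurnsideGroup P S :=
  lift
    { toFun := fun V => lift (of.comp (SpanClass.comp V))
      map_zero' := hom_ext fun U => by
        rw [lift_mk, map_zero]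
        exact map_zero of
      map_add' := fun V V' => hom_ext fun U => by
        rw [lift_mk, AddMonoidHom.add_apply, lift_mk, lift_mk, map_add]
        exact map_add of _ _ }

theorem comp_mk (V : BisetSpan Q S) (U : BisetSpan P Q) :
    comp (mk V) (mk U) = mk (BisetSpan.comp V U) := by
  rw [comp, lift_mk]
  exact lift_mk _ U

theorem comp_assoc (c : BurnsideGroup S T) (b : BurnsideGroup Q S) (a : BurnsideGroup P Q) :
    comp (comp c b) a = comp c (comp b a) := by
  have h1 : (comp.flip a).comp (comp.flip b) = (comp.flip (comp b a) : BurnsideGroup S T →+ BurnsideGroup P T) := by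
    refine hom_ext fun W => ?_
    change comp (comp (mk W) b) a = comp (mk W) (comp b a)
    have h2 : (comp.flip a).comp (comp (mk W)) = (comp (mk W)).comp (comp.flip a) := by
      refine hom_ext fun V => ?_
      change comp (comp (mk W) (mk V)) a = comp (mk W) (comp (mk V) a)
      have h3 : comp (P := P) (comp (mk W) (mk V)) =
          (comp (P := P) (mk W)).comp (comp (P := P) (mk V)) := by
        refine hom_ext fun U => ?_
        change comp (comp (mk W) (mk V)) (mk U) = comp (mk W) (comp (mk V) (mk U))
        rw [comp_mk, comp_mk, comp_mk, comp_mk]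
        exact mk_eq (BisetSpan.comp_assoc W V U)
      exact congrArg (fun F => F a) h3
    exact congrArg (fun F => F b) h2
  exact congrArg (fun F => F c) h1

theorem comp_id (a : BurnsideGroup P Q) : comp a (mk (BisetSpan.idSpan P)) = a := by
  have : (comp.flip (mk (BisetSpan.idSpan P)) : BurnsideGroup P Q →+ BurnsideGroup P Q) =
      AddMonoidHom.id _ := by
    refine hom_ext fun U => ?_
    change comp (mk U) (mk (BisetSpan.idSpan P)) = mk U
    rw [comp_mk]
    exact mk_eq (BisetSpan.comp_idSpan U)
  exact DFunLike.congr_fun this a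

theorem id_comp (a : BurnsideGroup P Q) : comp (mk (BisetSpan.idSpan Q)) a = a := by
  have : (comp (mk (BisetSpan.idSpan Q)) : BurnsideGroup P Q →+ BurnsideGroup P Q) =
      AddMonoidHom.id _ := by
    refine hom_ext fun U => ?_
    change comp (mk (BisetSpan.idSpan Q)) (mk U) = mk U
    rw [comp_mk]
    exact mk_eq (BisetSpan.idSpan_comp U)
  exact DFunLike.congr_fun this a

/-- Composition of the Burnside groups as a `ℤ`-bilinear map. -/
noncomputable def compₗ : BurnsideGroup Q S →ₗ[ℤ] BurnsideGroup P Q →ₗ[ℤ] BurnsideGroup P S :=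
  LinearMap.mk₂ ℤ (fun b a => comp b a) (fun _ _ _ => by simp) (fun _ _ _ => by simp)
    (fun _ _ _ => by simp) (fun _ _ _ => by simp)

theorem compₗ_apply (b : BurnsideGroup Q S) (a : BurnsideGroup P Q) : compₗ b a = comp b a := rfl

end BurnsideGroup

namespace FracObj

variable {R : Type v} [CommRing R]

/-- The morphisms `RB^{H, G}(Y, X) = R ⊗_ℤ B^{H × G}(Y × X)` from `P = X / G` to `Q = Y / H`. -/
def Hom (P Q : FracObj.{u} R) : Type (max v (u + 1)) := R ⊗[ℤ] BurnsideGroup P Q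

noncomputable instance (P Q : FracObj.{u} R) : AddCommGroup (Hom P Q) :=
  inferInstanceAs (AddCommGroup (R ⊗[ℤ] BurnsideGroup P Q))

noncomputable instance (P Q : FracObj.{u} R) : Module R (Hom P Q) :=
  inferInstanceAs (Module R (R ⊗[ℤ] BurnsideGroup P Q))

variable {P Q S T : FracObj.{u} R}

/-- The composition of morphisms: `(r ⊗ b) ∘ (s ⊗ a) = r s ⊗ (b ∘ a)`. -/
noncomputable def Hom.comp (g : Hom Q S) (f : Hom P Q) : Hom P S :=
  TensorProduct.map₂ (LinearMap.mul ℤ R) BurnsideGroup.compₗ g f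

/-- The morphism `r ⊗ a`. -/
noncomputable def Hom.tmul (r : R) (a : BurnsideGroup P Q) : Hom P Q := r ⊗ₜ[ℤ] a

theorem Hom.comp_tmul (r s : R) (b : BurnsideGroup Q S) (a : BurnsideGroup P Q) :
    Hom.comp (Hom.tmul r b) (Hom.tmul s a) = Hom.tmul (r * s) (BurnsideGroup.comp b a) := rfl

theorem Hom.add_comp (g g' : Hom Q S) (f : Hom P Q) :
    Hom.comp (g + g') f = Hom.comp g f + Hom.comp g' f :=
  DFunLike.congr_fun
    (map_add (TensorProduct.map₂ (LinearMap.mul ℤ R) BurnsideGroup.compₗ) g g') f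

theorem Hom.comp_add (g : Hom Q S) (f f' : Hom P Q) :
    Hom.comp g (f + f') = Hom.comp g f + Hom.comp g f' :=
  map_add (TensorProduct.map₂ (LinearMap.mul ℤ R) BurnsideGroup.compₗ g) _ _

theorem Hom.zero_comp (f : Hom P Q) : Hom.comp (0 : Hom Q S) f = 0 :=
  DFunLike.congr_fun
    (map_zero (TensorProduct.map₂ (LinearMap.mul ℤ R) BurnsideGroup.compₗ)) f

theorem Hom.comp_zero (g : Hom Q S) : Hom.comp g (0 : Hom P Q) = 0 :=
  map_zero (TensorProduct.map₂ (LinearMap.mul ℤ R) BurnsideGroup.compₗ g)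

theorem Hom.induction {motive : Hom P Q → Prop} (f : Hom P Q) (zero : motive 0)
    (tmul : ∀ (r : R) (a : BurnsideGroup P Q), motive (Hom.tmul r a))
    (add : ∀ f g, motive f → motive g → motive (f + g)) : motive f :=
  TensorProduct.induction_on f zero tmul add

theorem Hom.comp_assoc (h : Hom S T) (g : Hom Q S) (f : Hom P Q) :
    Hom.comp (Hom.comp h g) f = Hom.comp h (Hom.comp g f) := by
  induction h using Hom.induction with
  | zero => simp only [Hom.zero_comp]
  | add h h' e e' => simp only [Hom.add_comp, e, e']
  | tmul t c =>
    induction g using Hom.induction with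
    | zero => simp only [Hom.zero_comp, Hom.comp_zero]
    | add g g' e e' => simp only [Hom.add_comp, Hom.comp_add, e, e']
    | tmul s b =>
      induction f using Hom.induction with
      | zero => simp only [Hom.comp_zero]
      | add f f' e e' => simp only [Hom.comp_add, e, e']
      | tmul r a =>
        rw [Hom.comp_tmul, Hom.comp_tmul, Hom.comp_tmul, Hom.comp_tmul, mul_assoc,
          BurnsideGroup.comp_assoc]

/-- The category `𝒞_R`. -/
noncomputable instance : Category.{max v (u + 1)} (FracObj.{u} R) where
  Hom := Hom
  id P := Hom.tmul 1 (BurnsideGroup.mk (BisetSpan.idSpan P))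
  comp f g := Hom.comp g f
  id_comp f := by
    induction f using Hom.induction with
    | zero => exact Hom.zero_comp _
    | add f f' e e' => exact (Hom.add_comp _ _ _).trans (congrArg₂ _ e e')
    | tmul r a =>
      refine (Hom.comp_tmul _ _ _ _).trans ?_
      rw [mul_one, BurnsideGroup.comp_id]
  comp_id f := by
    induction f using Hom.induction with
    | zero => exact Hom.comp_zero _
    | add f f' e e' => exact (Hom.comp_add _ _ _).trans (congrArg₂ _ e e')
    | tmul r a =>
      refine (Hom.comp_tmul _ _ _ _).trans ?_
      rw [one_mul, BurnsideGroup.id_comp]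
  assoc f g h := (Hom.comp_assoc h g f).symm

noncomputable instance : Preadditive (FracObj.{u} R) where
  homGroup P Q := inferInstanceAs (AddCommGroup (Hom P Q))
  add_comp _ _ _ f f' g := Hom.comp_add g f f'
  comp_add _ _ _ f g g' := Hom.add_comp g g' f

/-- The morphism of `𝒞_R` given by a span. -/
noncomputable def ofSpan (U : BisetSpan P Q) : P ⟶ Q :=
  Hom.tmul 1 (BurnsideGroup.mk U)

theorem ofSpan_comp (U : BisetSpan P Q) (V : BisetSpan Q S) :
    ofSpan U ≫ ofSpan V = ofSpan (BisetSpan.comp V U) := by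
  refine (Hom.comp_tmul _ _ _ _).trans ?_
  rw [mul_one, BurnsideGroup.comp_mk]
  rfl

theorem ofSpan_id (P : FracObj.{u} R) : ofSpan (BisetSpan.idSpan P) = 𝟙 P := rfl

theorem ofSpan_eq {U V : BisetSpan P Q} (h : BisetSpan.Equivalent U V) : ofSpan U = ofSpan V :=
  congrArg (Hom.tmul 1) (BurnsideGroup.mk_eq h)

theorem ofSpan_disjUnion (U V : BisetSpan P Q) :
    ofSpan (BisetSpan.disjUnion U V) = ofSpan U + ofSpan V :=
  (congrArg (Hom.tmul 1) (BurnsideGroup.mk_disjUnion U V)).trans (TensorProduct.tmul_add _ _ _)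

theorem ofSpan_eq_zero {U : BisetSpan P Q} (h : IsEmpty U.carrier) : ofSpan U = 0 :=
  (congrArg (Hom.tmul 1) (BurnsideGroup.mk_eq_zero h)).trans (TensorProduct.tmul_zero _ _)

variable (R) in
/-- The object `X / G`. -/
abbrev frac (G X : Type u) [Group G] [Finite G] [MulAction G X] [Finite X] : FracObj.{u} R where
  grp := G
  pts := X

/-- The one-point set `{•}` on which a group acts trivially. -/
inductive Pt : Type u
  | pt

instance : Unique Pt.{u} := ⟨⟨Pt.pt⟩, fun x => by cases x; rfl⟩

instance (G : Type u) [Group G] : MulAction G Pt.{u} where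
  smul _ x := x
  one_smul _ := rfl
  mul_smul _ _ _ := rfl

variable (R) in
/-- The object `{•} / G`. -/
abbrev pt (G : Type u) [Group G] [Finite G] : FracObj.{u} R := frac R G Pt.{u}

/-- The zero object `∅ / {1}`. -/
def zeroObj : FracObj.{u} R where
  grp := PUnit
  pts := PEmpty
  action := { smul := fun _ => id, one_smul := fun _ => rfl, mul_smul := fun _ _ _ => rfl }

theorem isZero_zeroObj : IsZero (zeroObj : FracObj.{u} R) := by
  rw [IsZero.iff_id_eq_zero, ← ofSpan_id]
  exact ofSpan_eq_zero ⟨fun z => PEmpty.elim z.2⟩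

instance : HasZeroObject (FracObj.{u} R) := ⟨⟨zeroObj, isZero_zeroObj⟩⟩

/-- The sum `X / G ⊕ Y / H = ((X × H) ⊔ (G × Y)) / (G × H)`, with `(g, h) (x, h') = (g x, h h')` and
`(g, h) (g', y) = (g g', h y)`. -/
def sum (P Q : FracObj.{u} R) : FracObj.{u} R where
  grp := P.grp × Q.grp
  pts := (P.pts × Q.grp) ⊕ (P.grp × Q.pts)
  action :=
    { smul := fun a => Sum.map (fun z => (a.1 • z.1, a.2 * z.2)) (fun z => (a.1 * z.1, a.2 • z.2))
      one_smul := by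
        rintro (⟨x, h⟩ | ⟨g, y⟩)
        · exact congrArg Sum.inl (Prod.ext (one_smul _ x) (one_mul h))
        · exact congrArg Sum.inr (Prod.ext (one_mul g) (one_smul _ y))
      mul_smul := by
        rintro a b (⟨x, h⟩ | ⟨g, y⟩)
        · exact congrArg Sum.inl (Prod.ext (mul_smul _ _ x) (mul_assoc _ _ h))
        · exact congrArg Sum.inr (Prod.ext (mul_assoc _ _ g) (mul_smul _ _ y)) }

/-- The opposite span. -/
def opSpan (U : BisetSpan P Q) : BisetSpan Q P where
  carrier := U.carrier
  action := MulAction.compHom _ (MulEquiv.prodComm : P.grp × Q.grp ≃* Q.grp × P.grp).toMonoidHom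
  left := U.right
  right := U.left
  left_smul a u := U.right_smul a.swap u
  right_smul a u := U.left_smul a.swap u

/-- The span of the injection `X / G ⟶ X / G ⊕ Y / H`: the set `G × H × X` with
`((g₁, h₁), g₂) (g, h, x) = (g₁ g g₂⁻¹, h₁ h, g₁ x)` and the maps `(g, h, x) ↦ (x, h)` and
`(g, h, x) ↦ g⁻¹ x`. -/
def inlSpan (P Q : FracObj.{u} R) : BisetSpan P (sum P Q) where
  carrier := P.grp × Q.grp × P.pts
  action :=
    { smul := fun a z => (a.1.1 * z.1 * a.2⁻¹, a.1.2 * z.2.1, a.1.1 • z.2.2)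
      one_smul := fun z => Prod.ext (by change 1 * z.1 * 1⁻¹ = z.1; simp)
        (Prod.ext (one_mul _) (one_smul _ _))
      mul_smul := fun a b z => Prod.ext
        (by
          change (a.1.1 * b.1.1) * z.1 * (a.2 * b.2)⁻¹ = a.1.1 * (b.1.1 * z.1 * b.2⁻¹) * a.2⁻¹
          group)
        (Prod.ext (mul_assoc _ _ _) (mul_smul _ _ _)) }
  left := fun z => Sum.inl (z.2.2, z.2.1)
  right := fun z => z.1⁻¹ • z.2.2
  left_smul := fun _ _ => rfl
  right_smul := fun a z => by
    change (a.1.1 * z.1 * a.2⁻¹)⁻¹ • a.1.1 • z.2.2 = a.2 • z.1⁻¹ • z.2.2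
    simp [smul_smul, mul_assoc]

/-- The span of the injection `Y / H ⟶ X / G ⊕ Y / H`: the set `G × H × Y` with
`((g₁, h₁), h₂) (g, h, y) = (g₁ g, h₁ h h₂⁻¹, h₁ y)` and the maps `(g, h, y) ↦ (g, y)` and
`(g, h, y) ↦ h⁻¹ y`. -/
def inrSpan (P Q : FracObj.{u} R) : BisetSpan Q (sum P Q) where
  carrier := P.grp × Q.grp × Q.pts
  action :=
    { smul := fun a z => (a.1.1 * z.1, a.1.2 * z.2.1 * a.2⁻¹, a.1.2 • z.2.2)
      one_smul := fun z => Prod.ext (one_mul _)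
        (Prod.ext (by change 1 * z.2.1 * 1⁻¹ = z.2.1; simp) (one_smul _ _))
      mul_smul := fun a b z => Prod.ext (mul_assoc _ _ _) (Prod.ext
        (by
          change (a.1.2 * b.1.2) * z.2.1 * (a.2 * b.2)⁻¹ =
            a.1.2 * (b.1.2 * z.2.1 * b.2⁻¹) * a.2⁻¹
          group)
        (mul_smul _ _ _)) }
  left := fun z => Sum.inr (z.1, z.2.2)
  right := fun z => z.2.1⁻¹ • z.2.2
  left_smul := fun _ _ => rfl
  right_smul := fun a z => by
    change (a.1.2 * z.2.1 * a.2⁻¹)⁻¹ • a.1.2 • z.2.2 = a.2 • z.2.1⁻¹ • z.2.2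
    simp [smul_smul, mul_assoc]

theorem inl_fst_equivalent (P Q : FracObj.{u} R) :
    BisetSpan.Equivalent (BisetSpan.comp (opSpan (inlSpan P Q)) (inlSpan P Q))
      (BisetSpan.idSpan P) := by
  refine BisetSpan.comp_equivalent
    (fun w => (w.1.1.1⁻¹ * w.1.2.1, w.1.1.1⁻¹ • w.1.1.2.2))
    (fun z => ⟨((1, 1, z.2), (z.1, 1, z.2)), rfl⟩) ?_ ?_ ?_ ?_ ?_ ?_
  · rintro ⟨a, b⟩ ⟨⟨⟨g, h, x⟩, ⟨g', h', x'⟩⟩, hw⟩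
    refine Prod.ext ?_ ?_
    · change (a * g * 1⁻¹)⁻¹ * (a * g' * 1⁻¹) = g⁻¹ * g'
      group
    · change (a * g * 1⁻¹)⁻¹ • a • x = g⁻¹ • x
      simp [smul_smul]
  · rintro ⟨g, x⟩
    refine Prod.ext ?_ ?_
    · change (1 : P.grp)⁻¹ * g = g
      simp
    · change (1 : P.grp)⁻¹ • x = x
      simp
  · rintro ⟨⟨⟨g, h, x⟩, ⟨g', h', x'⟩⟩, hw⟩
    have hw : (Sum.inl (x, h) : (P.pts × Q.grp) ⊕ (P.grp × Q.pts)) = Sum.inl (x', h') := hw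
    obtain ⟨rfl, rfl⟩ := Prod.mk.inj (Sum.inl.inj hw)
    refine ⟨(g⁻¹, h⁻¹), BisetSpan.Pullback.ext ?_ ?_⟩
    · refine Prod.ext ?_ (Prod.ext ?_ rfl)
      · change g⁻¹ * g * 1⁻¹ = 1
        simp
      · exact inv_mul_cancel h
    · refine Prod.ext ?_ (Prod.ext ?_ rfl)
      · change g⁻¹ * g' * 1⁻¹ = g⁻¹ * g'
        simp
      · exact inv_mul_cancel h
  · rintro ⟨a, b⟩ ⟨⟨⟨g, h, x⟩, ⟨g', h', x'⟩⟩, hw⟩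
    refine Prod.ext ?_ ?_
    · change (1 * g * a⁻¹)⁻¹ * (1 * g' * b⁻¹) = a * (g⁻¹ * g') * b⁻¹
      group
    · change (1 * g * a⁻¹)⁻¹ • (1 : P.grp) • x = a • g⁻¹ • x
      simp [smul_smul]
  · rintro ⟨⟨⟨g, h, x⟩, ⟨g', h', x'⟩⟩, hw⟩
    rfl
  · rintro ⟨⟨⟨g, h, x⟩, ⟨g', h', x'⟩⟩, hw⟩
    have hw : (Sum.inl (x, h) : (P.pts × Q.grp) ⊕ (P.grp × Q.pts)) = Sum.inl (x', h') := hw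
    obtain ⟨rfl, rfl⟩ := Prod.mk.inj (Sum.inl.inj hw)
    change (g⁻¹ * g')⁻¹ • g⁻¹ • x = g'⁻¹ • x
    simp [smul_smul]

theorem inr_snd_equivalent (P Q : FracObj.{u} R) :
    BisetSpan.Equivalent (BisetSpan.comp (opSpan (inrSpan P Q)) (inrSpan P Q))
      (BisetSpan.idSpan Q) := by
  refine BisetSpan.comp_equivalent
    (fun w => (w.1.1.2.1⁻¹ * w.1.2.2.1, w.1.1.2.1⁻¹ • w.1.1.2.2))
    (fun z => ⟨((1, 1, z.2), (1, z.1, z.2)), rfl⟩) ?_ ?_ ?_ ?_ ?_ ?_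
  · rintro ⟨a, b⟩ ⟨⟨⟨g, h, x⟩, ⟨g', h', x'⟩⟩, hw⟩
    refine Prod.ext ?_ ?_
    · change (b * h * 1⁻¹)⁻¹ * (b * h' * 1⁻¹) = h⁻¹ * h'
      group
    · change (b * h * 1⁻¹)⁻¹ • b • x = h⁻¹ • x
      simp [smul_smul]
  · rintro ⟨g, x⟩
    refine Prod.ext ?_ ?_
    · change (1 : Q.grp)⁻¹ * g = g
      simp
    · change (1 : Q.grp)⁻¹ • x = x
      simp
  · rintro ⟨⟨⟨g, h, x⟩, ⟨g', h', x'⟩⟩, hw⟩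
    have hw : (Sum.inr (g, x) : (P.pts × Q.grp) ⊕ (P.grp × Q.pts)) = Sum.inr (g', x') := hw
    obtain ⟨rfl, rfl⟩ := Prod.mk.inj (Sum.inr.inj hw)
    refine ⟨(g⁻¹, h⁻¹), BisetSpan.Pullback.ext ?_ ?_⟩
    · refine Prod.ext ?_ (Prod.ext ?_ rfl)
      · exact inv_mul_cancel g
      · change h⁻¹ * h * 1⁻¹ = 1
        simp
    · refine Prod.ext ?_ (Prod.ext ?_ rfl)
      · exact inv_mul_cancel g
      · change h⁻¹ * h' * 1⁻¹ = h⁻¹ * h'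
        simp
  · rintro ⟨a, b⟩ ⟨⟨⟨g, h, x⟩, ⟨g', h', x'⟩⟩, hw⟩
    refine Prod.ext ?_ ?_
    · change (1 * h * a⁻¹)⁻¹ * (1 * h' * b⁻¹) = a * (h⁻¹ * h') * b⁻¹
      group
    · change (1 * h * a⁻¹)⁻¹ • (1 : Q.grp) • x = a • h⁻¹ • x
      simp [smul_smul]
  · rintro ⟨⟨⟨g, h, x⟩, ⟨g', h', x'⟩⟩, hw⟩
    rfl
  · rintro ⟨⟨⟨g, h, x⟩, ⟨g', h', x'⟩⟩, hw⟩
    have hw : (Sum.inr (g, x) : (P.pts × Q.grp) ⊕ (P.grp × Q.pts)) = Sum.inr (g', x') := hw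
    obtain ⟨rfl, rfl⟩ := Prod.mk.inj (Sum.inr.inj hw)
    change (h⁻¹ * h')⁻¹ • h⁻¹ • x = h'⁻¹ • x
    simp [smul_smul]

theorem total_equivalent (P Q : FracObj.{u} R) :
    BisetSpan.Equivalent
      (BisetSpan.disjUnion (BisetSpan.comp (inlSpan P Q) (opSpan (inlSpan P Q)))
        (BisetSpan.comp (inrSpan P Q) (opSpan (inrSpan P Q))))
      (BisetSpan.idSpan (sum P Q)) := by
  -- the parts of the identity span over the two summands
  let J1 : BisetSpan (sum P Q) (sum P Q) :=
    { carrier := {z : (BisetSpan.idSpan (sum P Q)).carrier // z.2.isLeft}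
      action :=
        { smul := fun a z => ⟨a • z.1, by
            obtain ⟨⟨c, x | y⟩, hz⟩ := z
            · rfl
            · cases hz⟩
          one_smul := fun z => Subtype.ext (one_smul _ z.1)
          mul_smul := fun a b z => Subtype.ext (mul_smul a b z.1) }
      finite_carrier := Subtype.finite
      left := fun z => (BisetSpan.idSpan (sum P Q)).left z.1
      right := fun z => (BisetSpan.idSpan (sum P Q)).right z.1
      left_smul := fun a z => (BisetSpan.idSpan (sum P Q)).left_smul a z.1
      right_smul := fun a z => (BisetSpan.idSpan (sum P Q)).right_smul a z.1 }
  let J2 : BisetSpan (sum P Q) (sum P Q) :=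
    { carrier := {z : (BisetSpan.idSpan (sum P Q)).carrier // z.2.isRight}
      action :=
        { smul := fun a z => ⟨a • z.1, by
            obtain ⟨⟨c, x | y⟩, hz⟩ := z
            · cases hz
            · rfl⟩
          one_smul := fun z => Subtype.ext (one_smul _ z.1)
          mul_smul := fun a b z => Subtype.ext (mul_smul a b z.1) }
      finite_carrier := Subtype.finite
      left := fun z => (BisetSpan.idSpan (sum P Q)).left z.1
      right := fun z => (BisetSpan.idSpan (sum P Q)).right z.1
      left_smul := fun a z => (BisetSpan.idSpan (sum P Q)).left_smul a z.1
      right_smul := fun a z => (BisetSpan.idSpan (sum P Q)).right_smul a z.1 }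
  have hJ : BisetSpan.Equivalent (BisetSpan.disjUnion J1 J2) (BisetSpan.idSpan (sum P Q)) := by
    refine ⟨Equiv.ofBijective (Sum.elim (fun z => z.1) (fun z => z.1)) ⟨?_, ?_⟩, ?_, ?_, ?_⟩
    · rintro (⟨z, hz⟩ | ⟨z, hz⟩) (⟨z', hz'⟩ | ⟨z', hz'⟩) h
      all_goals
        have h : z = z' := h
        subst h
      · rfl
      · obtain ⟨c, x | y⟩ := z
        · exact absurd hz' Bool.false_ne_true
        · exact absurd hz Bool.false_ne_true
      · obtain ⟨c, x | y⟩ := z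
        · exact absurd hz Bool.false_ne_true
        · exact absurd hz' Bool.false_ne_true
      · rfl
    · rintro ⟨c, x | y⟩
      · exact ⟨Sum.inl ⟨(c, Sum.inl x), rfl⟩, rfl⟩
      · exact ⟨Sum.inr ⟨(c, Sum.inr y), rfl⟩, rfl⟩
    · rintro a (z | z) <;> rfl
    · rintro (z | z) <;> rfl
    · rintro (z | z) <;> rfl
  have h1 : BisetSpan.Equivalent (BisetSpan.comp (inlSpan P Q) (opSpan (inlSpan P Q))) J1 := by
    refine BisetSpan.comp_equivalent
      (fun w => ⟨((w.1.1.1 * w.1.2.1⁻¹, w.1.1.2.1 * w.1.2.2.1⁻¹),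
        Sum.inl (w.1.1.2.2, w.1.1.2.1)), rfl⟩)
      (fun z => match z with
        | ⟨((g, h), Sum.inl (x, k)), _⟩ => ⟨((g, k, x), (1, h⁻¹ * k, g⁻¹ • x)), by
            change g⁻¹ • x = (1 : P.grp)⁻¹ • g⁻¹ • x
            simp⟩) ?_ ?_ ?_ ?_ ?_ ?_
    · rintro a ⟨⟨⟨g, h, x⟩, ⟨g', h', x'⟩⟩, hw⟩
      refine Subtype.ext (Prod.ext (Prod.ext ?_ ?_) (congrArg Sum.inl (Prod.ext ?_ ?_)))
      · change (1 * g * a⁻¹) * (1 * g' * a⁻¹)⁻¹ = g * g'⁻¹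
        group
      · change (1 * h) * (1 * h')⁻¹ = h * h'⁻¹
        group
      · exact one_smul P.grp x
      · exact one_mul h
    · rintro ⟨⟨⟨g, h⟩, ⟨x, k⟩ | y⟩, hz⟩
      · refine Subtype.ext (Prod.ext (Prod.ext ?_ ?_) rfl)
        · change g * 1⁻¹ = g
          simp
        · change k * (h⁻¹ * k)⁻¹ = h
          group
      · cases hz
    · rintro ⟨⟨⟨g, h, x⟩, ⟨g', h', x'⟩⟩, hw⟩
      have hw : g⁻¹ • x = g'⁻¹ • x' := hw
      refine ⟨g', BisetSpan.Pullback.ext ?_ ?_⟩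
      · refine Prod.ext ?_ (Prod.ext ?_ ?_)
        · change 1 * g * g'⁻¹ = g * g'⁻¹
          simp
        · exact one_mul h
        · exact one_smul P.grp x
      · refine Prod.ext ?_ (Prod.ext ?_ ?_)
        · change 1 * g' * g'⁻¹ = 1
          simp
        · change 1 * h' = (h * h'⁻¹)⁻¹ * h
          group
        · change (1 : P.grp) • x' = (g * g'⁻¹)⁻¹ • x
          rw [mul_inv_rev, mul_smul, hw]
          simp
    · rintro ⟨⟨a, b⟩, ⟨c, d⟩⟩ ⟨⟨⟨g, h, x⟩, ⟨g', h', x'⟩⟩, hw⟩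
      refine Subtype.ext (Prod.ext (Prod.ext ?_ ?_) rfl)
      · change (a * g * 1⁻¹) * (c * g' * 1⁻¹)⁻¹ = a * (g * g'⁻¹) * c⁻¹
        group
      · change (b * h) * (d * h')⁻¹ = b * (h * h'⁻¹) * d⁻¹
        group
    · rintro ⟨⟨⟨g, h, x⟩, ⟨g', h', x'⟩⟩, hw⟩
      rfl
    · rintro ⟨⟨⟨g, h, x⟩, ⟨g', h', x'⟩⟩, hw⟩
      have hw : g⁻¹ • x = g'⁻¹ • x' := hw
      refine congrArg Sum.inl (Prod.ext ?_ ?_)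
      · change (g * g'⁻¹)⁻¹ • x = x'
        rw [mul_inv_rev, mul_smul, hw]
        simp
      · change (h * h'⁻¹)⁻¹ * h = h'
        group
  have h2 : BisetSpan.Equivalent (BisetSpan.comp (inrSpan P Q) (opSpan (inrSpan P Q))) J2 := by
    refine BisetSpan.comp_equivalent
      (fun w => ⟨((w.1.1.1 * w.1.2.1⁻¹, w.1.1.2.1 * w.1.2.2.1⁻¹),
        Sum.inr (w.1.1.1, w.1.1.2.2)), rfl⟩)
      (fun z => match z with
        | ⟨((g, h), Sum.inr (k, y)), _⟩ => ⟨((k, h, y), (g⁻¹ * k, 1, h⁻¹ • y)), by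
            change h⁻¹ • y = (1 : Q.grp)⁻¹ • h⁻¹ • y
            simp⟩) ?_ ?_ ?_ ?_ ?_ ?_
    · rintro a ⟨⟨⟨g, h, x⟩, ⟨g', h', x'⟩⟩, hw⟩
      refine Subtype.ext (Prod.ext (Prod.ext ?_ ?_) (congrArg Sum.inr (Prod.ext ?_ ?_)))
      · change (1 * g) * (1 * g')⁻¹ = g * g'⁻¹
        group
      · change (1 * h * a⁻¹) * (1 * h' * a⁻¹)⁻¹ = h * h'⁻¹
        group
      · exact one_mul g
      · exact one_smul Q.grp x
    · rintro ⟨⟨⟨g, h⟩, x | ⟨k, y⟩⟩, hz⟩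
      · cases hz
      · refine Subtype.ext (Prod.ext (Prod.ext ?_ ?_) rfl)
        · change k * (g⁻¹ * k)⁻¹ = g
          group
        · change h * 1⁻¹ = h
          simp
    · rintro ⟨⟨⟨g, h, x⟩, ⟨g', h', x'⟩⟩, hw⟩
      have hw : h⁻¹ • x = h'⁻¹ • x' := hw
      refine ⟨h', BisetSpan.Pullback.ext ?_ ?_⟩
      · refine Prod.ext ?_ (Prod.ext ?_ ?_)
        · exact one_mul g
        · change 1 * h * h'⁻¹ = h * h'⁻¹
          simp
        · exact one_smul Q.grp x
      · refine Prod.ext ?_ (Prod.ext ?_ ?_)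
        · change 1 * g' = (g * g'⁻¹)⁻¹ * g
          group
        · change 1 * h' * h'⁻¹ = 1
          simp
        · change (1 : Q.grp) • x' = (h * h'⁻¹)⁻¹ • x
          rw [mul_inv_rev, mul_smul, hw]
          simp
    · rintro ⟨⟨a, b⟩, ⟨c, d⟩⟩ ⟨⟨⟨g, h, x⟩, ⟨g', h', x'⟩⟩, hw⟩
      refine Subtype.ext (Prod.ext (Prod.ext ?_ ?_) rfl)
      · change (a * g) * (c * g')⁻¹ = a * (g * g'⁻¹) * c⁻¹
        group
      · change (b * h * 1⁻¹) * (d * h' * 1⁻¹)⁻¹ = b * (h * h'⁻¹) * d⁻¹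
        group
    · rintro ⟨⟨⟨g, h, x⟩, ⟨g', h', x'⟩⟩, hw⟩
      rfl
    · rintro ⟨⟨⟨g, h, x⟩, ⟨g', h', x'⟩⟩, hw⟩
      have hw : h⁻¹ • x = h'⁻¹ • x' := hw
      refine congrArg Sum.inr (Prod.ext ?_ ?_)
      · change (g * g'⁻¹)⁻¹ * g = g'
        group
      · change (h * h'⁻¹)⁻¹ • x = x'
        rw [mul_inv_rev, mul_smul, hw]
        simp
  exact (BisetSpan.disjUnion_congr h1 h2).trans hJ

/-- The sum `((X × H) ⊔ (G × Y)) / (G × H)` with its injections and projections. -/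
noncomputable def sumBicone (P Q : FracObj.{u} R) : BinaryBicone P Q where
  pt := sum P Q
  fst := ofSpan (opSpan (inlSpan P Q))
  snd := ofSpan (opSpan (inrSpan P Q))
  inl := ofSpan (inlSpan P Q)
  inr := ofSpan (inrSpan P Q)
  inl_fst := by
    rw [ofSpan_comp, ← ofSpan_id]
    exact ofSpan_eq (inl_fst_equivalent P Q)
  inl_snd := by
    rw [ofSpan_comp]
    refine ofSpan_eq_zero ⟨?_⟩
    rintro ⟨⟨⟨_, _, _⟩, ⟨_, _, _⟩⟩, hw⟩
    exact Sum.inr_ne_inl hw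
  inr_fst := by
    rw [ofSpan_comp]
    refine ofSpan_eq_zero ⟨?_⟩
    rintro ⟨⟨⟨_, _, _⟩, ⟨_, _, _⟩⟩, hw⟩
    exact Sum.inl_ne_inr hw
  inr_snd := by
    rw [ofSpan_comp, ← ofSpan_id]
    exact ofSpan_eq (inr_snd_equivalent P Q)

/-- The sum `((X × H) ⊔ (G × Y)) / (G × H)` is the biproduct of `X / G` and `Y / H`. -/
noncomputable def sumBiconeIsBilimit (P Q : FracObj.{u} R) : (sumBicone P Q).IsBilimit :=
  isBinaryBilimitOfTotal _ (by
    have h : ofSpan (opSpan (inlSpan P Q)) ≫ ofSpan (inlSpan P Q) +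
        ofSpan (opSpan (inrSpan P Q)) ≫ ofSpan (inrSpan P Q) = 𝟙 (sum P Q) := by
      rw [ofSpan_comp, ofSpan_comp, ← ofSpan_disjUnion, ← ofSpan_id]
      exact ofSpan_eq (total_equivalent P Q)
    exact h)

instance : HasBinaryBiproducts (FracObj.{u} R) :=
  ⟨fun P Q => ⟨⟨⟨sumBicone P Q, sumBiconeIsBilimit P Q⟩⟩⟩⟩

/-- `𝒞_R` has finite direct sums. -/
instance : HasFiniteBiproducts (FracObj.{u} R) :=
  haveI : HasFiniteProducts (FracObj.{u} R) := hasFiniteProducts_of_has_binary_and_terminal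
  HasFiniteBiproducts.of_hasFiniteProducts

end FracObj

/-! Existence is the orbit-stabilizer principle. A point x of X with stabilizer S gives a span from
{•}/S to X/G with carrier G and leg g ↦ g x. Followed by its opposite it gives the identity of
{•}/S; in the other order it gives the part of the identity span of X/G over the orbit of x
(`opSpan_comp_pointSpan`, `pointSpan_comp_opSpan`). These parts add up to the identity.

Since R is arbitrary, uniqueness is drawn from numerical invariants rather than from local
endomorphism rings. Fix a one-point object K. A point of a span from K to P has a stabilizer M in
`P.grp × K.grp`; it is faithful if M maps onto `K.grp` and meets `K.grp` trivially. Then M embeds in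
`P.grp`, so |K| ≤ |P|, and equality forces M to be the graph of an isomorphism. A faithful point of
a composite yields one of its first factor (`IsFaithfulPoint.of_comp`), so spans without faithful
points are stable under postcomposition. The linear forms on Hom(K, P) that kill them, with values
in a residue field 𝕜 of R, are therefore an additive contravariant functor of P, with
finite-dimensional values.

Its dimension `faithfulRank 𝕜 K P` is additive over direct sums, nonzero for P = K, and zero if |P|
≤ |K| and the groups are not isomorphic. A matrix triangular in this sense separates multisets of
groups (`Multiset.eq_of_triangular`).

Indecomposability is a count: both terms of a splitting of {•}/G decompose into one-point objects,
and uniqueness leaves room for a single one, so one term is an empty sum. -/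

namespace BisetSpan

/-! ### Cutting spans into orbits -/

variable {R : Type v} {P Q S : FracObj.{u} R}

/-- The part of a span where a colouring, constant on orbits, takes a colour in `s`. -/
def restrict {I : Type*} (U : BisetSpan P Q) (c : U.carrier → I)
    (hc : ∀ (a : Q.grp × P.grp) u, c (a • u) = c u) (s : Set I) : BisetSpan P Q where
  carrier := {u : U.carrier // c u ∈ s}
  action :=
    { smul := fun a u => ⟨a • u.1, (hc a u.1).symm ▸ u.2⟩
      one_smul := fun u => Subtype.ext (one_smul _ u.1)
      mul_smul := fun a b u => Subtype.ext (mul_smul a b u.1) }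
  finite_carrier := Subtype.finite
  left u := U.left u.1
  right u := U.right u.1
  left_smul a u := U.left_smul a u.1
  right_smul a u := U.right_smul a u.1

theorem restrict_insert {I : Type*} (U : BisetSpan P Q) (c : U.carrier → I)
    (hc : ∀ (a : Q.grp × P.grp) u, c (a • u) = c u) {i : I} {s : Set I} (hi : i ∉ s) :
    Equivalent (disjUnion (restrict U c hc {i}) (restrict U c hc s))
      (restrict U c hc (insert i s)) := by
  let f : (disjUnion (restrict U c hc {i}) (restrict U c hc s)).carrier →
      (restrict U c hc (insert i s)).carrier :=
    Sum.elim (fun u => ⟨u.1, Or.inl u.2⟩) (fun u => ⟨u.1, Or.inr u.2⟩)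
  have hf : Function.Bijective f := by
    constructor
    · rintro (⟨u, hu⟩ | ⟨u, hu⟩) (⟨w, hw⟩ | ⟨w, hw⟩) h <;>
        obtain rfl : u = w := congrArg Subtype.val h
      · rfl
      · obtain rfl : c u = i := hu
        exact absurd hw hi
      · obtain rfl : c u = i := hw
        exact absurd hu hi
      · rfl
    · rintro ⟨u, hu | hu⟩
      · exact ⟨Sum.inl ⟨u, hu⟩, rfl⟩
      · exact ⟨Sum.inr ⟨u, hu⟩, rfl⟩
  refine ⟨Equiv.ofBijective f hf, ?_, ?_, ?_⟩
  · rintro a (u | u) <;> rfl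
  · rintro (u | u) <;> rfl
  · rintro (u | u) <;> rfl

theorem restrict_univ {I : Type*} (U : BisetSpan P Q) (c : U.carrier → I)
    (hc : ∀ (a : Q.grp × P.grp) u, c (a • u) = c u) {s : Set I} (hs : ∀ i, i ∈ s) :
    Equivalent (restrict U c hc s) U :=
  ⟨Equiv.subtypeUnivEquiv fun u => hs (c u), fun _ _ => rfl, fun _ => rfl, fun _ => rfl⟩

/-- Two transitive spans are isomorphic as soon as they have points with the same stabilizer and
the same images. -/
theorem equivalent_of_transitive {U V : BisetSpan P Q} (u : U.carrier) (v : V.carrier)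
    (hu : ∀ w, ∃ a : Q.grp × P.grp, a • u = w) (hv : ∀ w, ∃ a : Q.grp × P.grp, a • v = w)
    (hst : MulAction.stabilizer (Q.grp × P.grp) u = MulAction.stabilizer (Q.grp × P.grp) v)
    (hl : U.left u = V.left v) (hr : U.right u = V.right v) : Equivalent U V := by
  -- Equal stabilizers mean that the two orbit maps have the same fibres, so `a • u ↦ a • v` is well
  -- defined and injective.
  have key : ∀ a b : Q.grp × P.grp, a • u = b • u ↔ a • v = b • v := fun a b => by
    rw [← inv_smul_eq_iff (g := b), ← inv_smul_eq_iff (g := b), smul_smul, smul_smul,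
      ← MulAction.mem_stabilizer_iff, ← MulAction.mem_stabilizer_iff, hst]
  choose r hr' using hu
  have hrv : ∀ a : Q.grp × P.grp, r (a • u) • v = a • v := fun a => (key _ _).1 (hr' _)
  refine ⟨Equiv.ofBijective (fun w => r w • v) ⟨fun w w' h => ?_, fun w => ?_⟩, ?_, ?_, ?_⟩
  · rw [← hr' w, ← hr' w']
    exact (key _ _).2 h
  · obtain ⟨a, rfl⟩ := hv w
    exact ⟨a • u, hrv a⟩
  · intro a w
    change r (a • w) • v = a • r w • v
    rw [smul_smul, ← hrv (a * r w), mul_smul, hr' w]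
  · intro w
    change V.left (r w • v) = U.left w
    rw [V.left_smul, ← hl, ← U.left_smul, hr' w]
  · intro w
    change V.right (r w • v) = U.right w
    rw [V.right_smul, ← hr, ← U.right_smul, hr' w]

/-! ### Faithful points -/

/-- A point of a span from `P` to `Q` is faithful if its stabilizer in `Q.grp × P.grp` projects onto
`P.grp` and meets `P.grp` trivially. -/
def IsFaithfulPoint (U : BisetSpan P Q) (u : U.carrier) : Prop :=
  (∀ k : P.grp, ∃ g : Q.grp, (g, k) • u = u) ∧
    ∀ k : P.grp, ((1, k) : Q.grp × P.grp) • u = u → k = 1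

/-- If (y, k) fixes the class of (v, u), some x in the middle group satisfies x · (v, u) = (y, k) ·
(v, u). Comparing second coordinates, (x⁻¹, k) fixes u. Conversely, what fixes u in `P.grp` alone
also fixes the class. -/
theorem IsFaithfulPoint.of_comp {V : BisetSpan Q S} {U : BisetSpan P Q} {w : Pullback V U}
    (h : IsFaithfulPoint (comp V U) (Quotient.mk _ w)) : IsFaithfulPoint U w.1.2 := by
  constructor
  · intro k
    obtain ⟨y, hy⟩ := h.1 k
    have hy : (Quotient.mk (MulAction.orbitRel Q.grp (Pullback V U)) (Pullback.outer (y, k) w)) =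
      Quotient.mk _ w := hy
    obtain ⟨x, hx⟩ := Quotient.exact hy
    have hx : ((x, 1) : Q.grp × P.grp) • w.1.2 = ((1, k) : Q.grp × P.grp) • w.1.2 :=
      congrArg (fun w => w.1.2) hx
    refine ⟨x⁻¹, ?_⟩
    calc ((x⁻¹, k) : Q.grp × P.grp) • w.1.2
        = ((x⁻¹, 1) : Q.grp × P.grp) • ((1, k) : Q.grp × P.grp) • w.1.2 := by simp [smul_smul]
      _ = w.1.2 := by
        rw [← hx, smul_smul, Prod.mk_mul_mk, inv_mul_cancel, one_mul]
        exact one_smul (Q.grp × P.grp) _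
  · intro k hk
    refine h.2 k (congrArg (Quotient.mk _) (Pullback.ext ?_ hk))
    exact one_smul (S.grp × Q.grp) _

/-- Choose for each k a partner `g k` with `(g k, k)` in the stabilizer. If k and k' share a
partner, the quotient of the two pairs is (1, k⁻¹k'), which is trivial by faithfulness. -/
theorem IsFaithfulPoint.card_le {U : BisetSpan P Q} {u : U.carrier} (h : IsFaithfulPoint U u) :
    Nat.card P.grp ≤ Nat.card Q.grp := by
  choose g hg using h.1
  refine Nat.card_le_card_of_injective g fun k k' hk => ?_
  have h1 := h.2 (k⁻¹ * k') (by
    have : ((1, k⁻¹ * k') : Q.grp × P.grp) = (g k, k)⁻¹ * (g k', k') := by simp [hk]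
    rw [this, mul_smul, hg, inv_smul_eq_iff, hg])
  exact inv_mul_eq_one.1 h1

/-- The stabilizer M embeds in `Q.grp` and maps onto `P.grp`. When the orders agree both projections
are bijective, and M is the graph of an isomorphism. -/
theorem IsFaithfulPoint.nonempty_mulEquiv {U : BisetSpan P Q} {u : U.carrier}
    (h : IsFaithfulPoint U u) (hle : Nat.card Q.grp ≤ Nat.card P.grp) :
    Nonempty (P.grp ≃* Q.grp) := by
  have hcard := h.card_le.antisymm hle
  let M := MulAction.stabilizer (Q.grp × P.grp) u
  let p₁ : M →* Q.grp := (MonoidHom.fst _ _).comp M.subtype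
  let p₂ : M →* P.grp := (MonoidHom.snd _ _).comp M.subtype
  have h₁ : Function.Injective p₁ := by
    refine (injective_iff_map_eq_one _).2 ?_
    rintro ⟨⟨g, k⟩, hm⟩ hg
    obtain rfl : g = 1 := hg
    exact Subtype.ext (Prod.ext rfl (h.2 k hm))
  have h₂ : Function.Surjective p₂ := fun k => by
    obtain ⟨g, hg⟩ := h.1 k
    exact ⟨⟨(g, k), hg⟩, rfl⟩
  have c₁ : Nat.card M ≤ Nat.card Q.grp := Nat.card_le_card_of_injective _ h₁
  have c₂ : Nat.card P.grp ≤ Nat.card M := Nat.card_le_card_of_surjective _ h₂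
  have b₁ : Function.Bijective p₁ := h₁.bijective_of_nat_card_le (by omega)
  have b₂ : Function.Bijective p₂ := h₂.bijective_of_nat_card_le (by omega)
  exact ⟨(MulEquiv.ofBijective p₂ b₂).symm.trans (MulEquiv.ofBijective p₁ b₁)⟩

/-- The orbits of a span which contain a faithful point. -/
def faithfulOrbits (U : BisetSpan P Q) : Set (Set U.carrier) :=
  MulAction.orbit (Q.grp × P.grp) '' {u | IsFaithfulPoint U u}

theorem ncard_faithfulOrbits_eq_of_equivalent {U V : BisetSpan P Q} (h : Equivalent U V) :
    U.faithfulOrbits.ncard = V.faithfulOrbits.ncard := by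
  obtain ⟨e, he, -, -⟩ := h
  have hf : ∀ u, IsFaithfulPoint V (e u) ↔ IsFaithfulPoint U u := fun u => by
    simp only [IsFaithfulPoint, ← he, e.apply_eq_iff_eq]
  have ho : ∀ u, MulAction.orbit (Q.grp × P.grp) (e u) =
      e '' MulAction.orbit (Q.grp × P.grp) u := fun u => by
    simp only [MulAction.orbit, ← Set.range_comp, Function.comp_def, he]
  have : V.faithfulOrbits = Set.image e '' U.faithfulOrbits := by
    rw [faithfulOrbits, faithfulOrbits, Set.image_image]
    ext s
    constructor
    · rintro ⟨v, hv, rfl⟩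
      obtain ⟨u, rfl⟩ := e.surjective v
      exact ⟨u, (hf u).1 hv, (ho u).symm⟩
    · rintro ⟨u, hu, rfl⟩
      exact ⟨e u, (hf u).2 hu, ho u⟩
  rw [this, Set.ncard_image_of_injective _ e.injective.image_injective]

/-- Together with invariance under isomorphism, this additivity lets the count extend to the
Burnside group. -/
theorem ncard_faithfulOrbits_disjUnion (U V : BisetSpan P Q) :
    (disjUnion U V).faithfulOrbits.ncard =
      U.faithfulOrbits.ncard + V.faithfulOrbits.ncard := by
  let i : U.carrier → (disjUnion U V).carrier := Sum.inl
  let j : V.carrier → (disjUnion U V).carrier := Sum.inr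
  have hi : Function.Injective i := Sum.inl_injective
  have hj : Function.Injective j := Sum.inr_injective
  have hl : ∀ u, MulAction.orbit (Q.grp × P.grp) (i u) =
      i '' MulAction.orbit (Q.grp × P.grp) u := fun u => by
    simp only [MulAction.orbit, ← Set.range_comp]
    rfl
  have hr : ∀ v, MulAction.orbit (Q.grp × P.grp) (j v) =
      j '' MulAction.orbit (Q.grp × P.grp) v := fun v => by
    simp only [MulAction.orbit, ← Set.range_comp]
    rfl
  have fl : ∀ u, IsFaithfulPoint (disjUnion U V) (i u) ↔ IsFaithfulPoint U u :=
    fun u => and_congr (forall_congr' fun _ => exists_congr fun _ => hi.eq_iff)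
      (forall_congr' fun _ => imp_congr_left hi.eq_iff)
  have fr : ∀ v, IsFaithfulPoint (disjUnion U V) (j v) ↔ IsFaithfulPoint V v :=
    fun v => and_congr (forall_congr' fun _ => exists_congr fun _ => hj.eq_iff)
      (forall_congr' fun _ => imp_congr_left hj.eq_iff)
  have : (disjUnion U V).faithfulOrbits =
      Set.image i '' U.faithfulOrbits ∪ Set.image j '' V.faithfulOrbits := by
    rw [faithfulOrbits, faithfulOrbits, faithfulOrbits, Set.image_image, Set.image_image]
    ext s
    constructor
    · rintro ⟨u | v, hw, rfl⟩
      · exact Or.inl ⟨u, (fl u).1 hw, (hl u).symm⟩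
      · exact Or.inr ⟨v, (fr v).1 hw, (hr v).symm⟩
    · rintro (⟨u, hu, rfl⟩ | ⟨v, hv, rfl⟩)
      · exact ⟨i u, (fl u).2 hu, hl u⟩
      · exact ⟨j v, (fr v).2 hv, hr v⟩
  rw [this, Set.ncard_union_eq _ (Set.toFinite _) (Set.toFinite _),
    Set.ncard_image_of_injective _ hi.image_injective,
    Set.ncard_image_of_injective _ hj.image_injective]
  rw [Set.disjoint_left]
  rintro _ ⟨_, ⟨u, hu, rfl⟩, rfl⟩ ⟨_, ⟨v, hv, rfl⟩, h⟩
  obtain ⟨_, _, hx⟩ : i u ∈ j '' MulAction.orbit (Q.grp × P.grp) v :=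
    h.symm ▸ ⟨u, MulAction.mem_orbit_self u, rfl⟩
  exact Sum.inr_ne_inl hx

theorem faithfulOrbits_eq_empty {U : BisetSpan P Q} (h : ∀ u, ¬ IsFaithfulPoint U u) :
    U.faithfulOrbits = ∅ := by
  rw [faithfulOrbits, Set.image_eq_empty]
  exact Set.eq_empty_of_forall_notMem h

/-- Over a one-point set the identity span is the group under left and right translation: it is
transitive, and the stabilizer of 1 is the diagonal, which is faithful. -/
theorem ncard_faithfulOrbits_idSpan (P : FracObj.{u} R) [Unique P.pts] :
    (idSpan P).faithfulOrbits.ncard = 1 := by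
  have ho : ∀ z : (idSpan P).carrier, MulAction.orbit (P.grp × P.grp) z = Set.univ := fun z => by
    refine Set.eq_univ_of_forall fun w => ⟨(w.1 * z.1⁻¹, 1), Prod.ext ?_ (Subsingleton.elim _ _)⟩
    change w.1 * z.1⁻¹ * z.1 * 1⁻¹ = w.1
    simp
  rw [Set.ncard_eq_one]
  refine ⟨Set.univ, Set.eq_singleton_iff_unique_mem.2 ⟨⟨((1, default) : P.grp × P.pts), ⟨?_, ?_⟩,
    ho _⟩, ?_⟩⟩
  · refine fun k => ⟨k, Prod.ext ?_ (Subsingleton.elim _ _)⟩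
    change k * 1 * k⁻¹ = 1
    simp
  · intro k hk
    have hk : 1 * 1 * k⁻¹ = 1 := congrArg Prod.fst hk
    simpa using hk
  · rintro _ ⟨z, -, rfl⟩
    exact ho z

end BisetSpan

/-! ### Linear structure and generation by transitive spans -/

namespace FracObj

variable {R : Type v} [CommRing R] {P Q S : FracObj.{u} R}

/-- Used with two colourings: the orbits of the span itself, for generation by transitive spans, and
the orbits of X on the identity span of X/G, for the orbit decomposition. -/
theorem ofSpan_eq_sum_restrict {I : Type*} [Fintype I] (U : BisetSpan P Q) (c : U.carrier → I)
    (hc : ∀ (a : Q.grp × P.grp) u, c (a • u) = c u) :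
    ofSpan U = ∑ i, ofSpan (BisetSpan.restrict U c hc {i}) := by
  classical
  have h : ∀ s : Finset I, ofSpan (BisetSpan.restrict U c hc (s : Set I)) =
      ∑ i ∈ s, ofSpan (BisetSpan.restrict U c hc {i}) := by
    intro s
    induction s using Finset.induction_on with
    | empty => exact ofSpan_eq_zero ⟨fun u => by simpa using u.2⟩
    | insert i s hi ih =>
      rw [Finset.sum_insert hi, ← ih, ← ofSpan_disjUnion, Finset.coe_insert]
      exact (ofSpan_eq (BisetSpan.restrict_insert U c hc (by simpa using hi))).symm
  rw [← h]
  exact (ofSpan_eq (BisetSpan.restrict_univ U c hc (by simp))).symm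

theorem Hom.smul_tmul (r s : R) (a : BurnsideGroup P Q) :
    r • Hom.tmul s a = Hom.tmul (r * s) a := rfl

theorem Hom.comp_smul (g : Hom Q S) (r : R) (f : Hom P Q) :
    Hom.comp g (r • f) = r • Hom.comp g f := by
  induction f using Hom.induction with
  | zero => simp only [smul_zero, Hom.comp_zero]
  | add f f' e e' => simp only [smul_add, Hom.comp_add, e, e']
  | tmul s a =>
    induction g using Hom.induction with
    | zero => simp only [smul_zero, Hom.zero_comp]
    | add g g' e e' => simp only [smul_add, Hom.add_comp, e, e']
    | tmul t b =>
      rw [Hom.smul_tmul, Hom.comp_tmul, Hom.comp_tmul, Hom.smul_tmul, mul_left_comm]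

theorem Hom.smul_comp (r : R) (g : Hom Q S) (f : Hom P Q) :
    Hom.comp (r • g) f = r • Hom.comp g f := by
  induction f using Hom.induction with
  | zero => simp only [smul_zero, Hom.comp_zero]
  | add f f' e e' => simp only [smul_add, Hom.comp_add, e, e']
  | tmul s a =>
    induction g using Hom.induction with
    | zero => simp only [smul_zero, Hom.zero_comp]
    | add g g' e e' => simp only [smul_add, Hom.add_comp, e, e']
    | tmul t b =>
      rw [Hom.smul_tmul, Hom.comp_tmul, Hom.comp_tmul, Hom.smul_tmul, mul_assoc]

/-- The two scalar lemmas trade places because `≫` reverses the order of `Hom.comp`. -/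
noncomputable instance : Linear R (FracObj.{u} R) where
  homModule P Q := inferInstanceAs (Module R (Hom P Q))
  smul_comp _ _ _ r f g := Hom.comp_smul g r f
  comp_smul _ _ _ f r g := Hom.smul_comp r g f

theorem Hom.tmul_mk (r : R) (U : BisetSpan P Q) :
    (Hom.tmul r (BurnsideGroup.mk U) : P ⟶ Q) = r • ofSpan U :=
  (congrArg (fun s => Hom.tmul s _) (mul_one r)).symm

/-- A submodule which contains the spans contains all morphisms. -/
theorem mem_of_ofSpan_mem (N : Submodule R (P ⟶ Q)) (h : ∀ U : BisetSpan P Q, ofSpan U ∈ N)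
    (f : P ⟶ Q) : f ∈ N := by
  induction f using Hom.induction with
  | zero => exact N.zero_mem
  | add f g hf hg => exact N.add_mem hf hg
  | tmul r a =>
    -- Spans generate the Burnside group only as a group. For fixed r, membership of r ⊗ a in N is
    -- the vanishing of an additive map in a, which can be tested on spans.
    let F : BurnsideGroup P Q →+ (P ⟶ Q) ⧸ N :=
      { toFun := fun a => N.mkQ (Hom.tmul r a : P ⟶ Q)
        map_zero' := by
          rw [← map_zero N.mkQ]
          exact congrArg N.mkQ (TensorProduct.tmul_zero _ _)
        map_add' := fun a b => by
          rw [← map_add]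
          exact congrArg N.mkQ (TensorProduct.tmul_add _ _ _) }
    have hF : F = 0 := BurnsideGroup.hom_ext fun U => by
      change N.mkQ (Hom.tmul r (BurnsideGroup.mk U) : P ⟶ Q) = 0
      rw [Hom.tmul_mk]
      exact (Submodule.Quotient.mk_eq_zero N).2 (N.smul_mem r (h U))
    exact (Submodule.Quotient.mk_eq_zero N).1 (DFunLike.congr_fun hF a)

variable (P Q) in
/-- The morphisms given by transitive spans. -/
def transitiveHoms : Set (P ⟶ Q) :=
  {f | ∃ U : BisetSpan P Q, (∃ u : U.carrier, ∀ w, ∃ a : Q.grp × P.grp, a • u = w) ∧ ofSpan U = f}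

/-- A transitive span is determined up to isomorphism by the stabilizer and the two images of a base
point, and there are finitely many such triples. -/
theorem finite_transitiveHoms : (transitiveHoms P Q).Finite := by
  let c : transitiveHoms P Q → Subgroup (Q.grp × P.grp) × Q.pts × P.pts := fun f =>
    (MulAction.stabilizer _ f.2.choose_spec.1.choose,
      f.2.choose.left f.2.choose_spec.1.choose, f.2.choose.right f.2.choose_spec.1.choose)
  refine Set.finite_coe_iff.1 (Finite.of_injective c fun f g h => Subtype.ext ?_)
  rw [← f.2.choose_spec.2, ← g.2.choose_spec.2]
  exact ofSpan_eq (BisetSpan.equivalent_of_transitive _ _ f.2.choose_spec.1.choose_spec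
    g.2.choose_spec.1.choose_spec (congrArg Prod.fst h) (congrArg (fun x => x.2.1) h)
    (congrArg (fun x => x.2.2) h))

theorem span_transitiveHoms : Submodule.span R (transitiveHoms P Q) = ⊤ := by
  refine Submodule.eq_top_iff'.2 (mem_of_ofSpan_mem _ fun U => ?_)
  have : Fintype (MulAction.orbitRel.Quotient (Q.grp × P.grp) U.carrier) :=
    @Fintype.ofFinite _ (Quotient.finite _)
  let c : U.carrier → MulAction.orbitRel.Quotient (Q.grp × P.grp) U.carrier := Quotient.mk _
  have hc : ∀ (a : Q.grp × P.grp) u, c (a • u) = c u := fun a u => Quotient.sound ⟨a, rfl⟩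
  rw [ofSpan_eq_sum_restrict U c hc]
  refine Submodule.sum_mem _ fun i _ => Submodule.subset_span ⟨_, ?_, rfl⟩
  obtain ⟨u, rfl⟩ : ∃ u, c u = i := Quotient.exists_rep i
  refine ⟨⟨u, rfl⟩, fun w => ?_⟩
  obtain ⟨a, ha⟩ := Quotient.exact (show c w.1 = c u from w.2)
  exact ⟨a, Subtype.ext ha⟩

/-! ### Linear forms that see only faithful points -/

section Functionals

variable (𝕜 : Type*) [Field 𝕜] [Algebra R 𝕜]

/-- The linear forms on the morphisms from `K` to `P` which vanish on the spans without faithful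
points. -/
def faithfulForms (K P : FracObj.{u} R) : Submodule 𝕜 ((K ⟶ P) →ₗ[R] 𝕜) where
  carrier := {φ | ∀ U : BisetSpan K P, (∀ u, ¬ U.IsFaithfulPoint u) → φ (ofSpan U) = 0}
  add_mem' h h' U hU := by rw [LinearMap.add_apply, h U hU, h' U hU, add_zero]
  zero_mem' _ _ := rfl
  smul_mem' c φ h U hU := by rw [LinearMap.smul_apply, h U hU, smul_zero]

/-- Forms are determined by their values on the finite generating set of transitive spans.
Finiteness is what makes a nonzero space have nonzero `finrank`. -/
instance finiteDimensional_faithfulForms (K P : FracObj.{u} R) :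
    FiniteDimensional 𝕜 (faithfulForms 𝕜 K P) := by
  have : Finite (transitiveHoms K P) := finite_transitiveHoms
  let F : faithfulForms 𝕜 K P →ₗ[𝕜] (transitiveHoms K P → 𝕜) :=
    { toFun := fun φ f => φ.1 f.1
      map_add' := fun _ _ => rfl
      map_smul' := fun _ _ => rfl }
  refine Module.Finite.of_injective F fun φ ψ h => Subtype.ext ?_
  exact LinearMap.ext_on span_transitiveHoms fun f hf => congrFun h ⟨f, hf⟩

/-- Spans without faithful points are stable under composition on the left. -/
theorem apply_comp_eq_zero {K : FracObj.{u} R} {φ : (K ⟶ Q) →ₗ[R] 𝕜}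
    (hφ : φ ∈ faithfulForms 𝕜 K Q) (f : P ⟶ Q) {U : BisetSpan K P}
    (hU : ∀ u, ¬ U.IsFaithfulPoint u) : φ (ofSpan U ≫ f) = 0 := by
  -- For fixed U the condition on f is linear, so f may be taken to be a span V.
  refine mem_of_ofSpan_mem (LinearMap.ker (φ.comp (Linear.leftComp R Q (ofSpan U)))) (fun V => ?_) f
  change φ (ofSpan U ≫ ofSpan V) = 0
  rw [ofSpan_comp]
  refine hφ _ ?_
  rintro ⟨w⟩ hw
  exact hU _ (BisetSpan.IsFaithfulPoint.of_comp hw)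

/-- Pulling back linear forms along composition with a morphism. -/
noncomputable def faithfulFormsMap (K : FracObj.{u} R) (f : P ⟶ Q) :
    faithfulForms 𝕜 K Q →ₗ[𝕜] faithfulForms 𝕜 K P where
  toFun φ := ⟨φ.1.comp (Linear.rightComp R K f), fun _ hU => apply_comp_eq_zero 𝕜 φ.2 f hU⟩
  map_add' _ _ := rfl
  map_smul' _ _ := rfl

theorem faithfulFormsMap_id (K : FracObj.{u} R) :
    faithfulFormsMap 𝕜 K (𝟙 P) = LinearMap.id := by
  ext φ a
  exact congrArg φ.1 (Category.comp_id a)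

theorem faithfulFormsMap_comp (K : FracObj.{u} R) (f : P ⟶ Q) (g : Q ⟶ S) :
    faithfulFormsMap 𝕜 K (f ≫ g) = (faithfulFormsMap 𝕜 K f).comp (faithfulFormsMap 𝕜 K g) := by
  ext φ a
  exact congrArg φ.1 (Category.assoc a f g).symm

theorem faithfulFormsMap_add (K : FracObj.{u} R) (f g : P ⟶ Q) :
    faithfulFormsMap 𝕜 K (f + g) = faithfulFormsMap 𝕜 K f + faithfulFormsMap 𝕜 K g := by
  ext φ a
  exact (congrArg φ.1 (Preadditive.comp_add _ _ _ a f g)).trans (map_add φ.1 _ _)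

/-- `faithfulFormsMap` as a homomorphism of groups. -/
noncomputable def faithfulFormsMapHom (K P Q : FracObj.{u} R) :
    (P ⟶ Q) →+ (faithfulForms 𝕜 K Q →ₗ[𝕜] faithfulForms 𝕜 K P) where
  toFun := faithfulFormsMap 𝕜 K
  map_zero' := by
    ext φ a
    exact (congrArg φ.1 comp_zero).trans (map_zero φ.1)
  map_add' := faithfulFormsMap_add 𝕜 K

theorem faithfulForms_eq_bot {K : FracObj.{u} R}
    (h : ∀ (U : BisetSpan K P) u, ¬ U.IsFaithfulPoint u) : faithfulForms 𝕜 K P = ⊥ := by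
  refine (Submodule.eq_bot_iff _).2 fun φ hφ => LinearMap.ext fun f => ?_
  exact mem_of_ofSpan_mem (LinearMap.ker φ) (fun U => hφ U (h U)) f

/-- The number of orbits with a faithful point, as a linear form. -/
noncomputable def faithfulCount (K P : FracObj.{u} R) : (K ⟶ P) →ₗ[R] 𝕜 :=
  LinearMap.toSpanSingleton R 𝕜 1 ∘ₗ (TensorProduct.AlgebraTensorModule.lift
    (LinearMap.toSpanSingleton R (BurnsideGroup K P →ₗ[ℤ] R)
      (BurnsideGroup.lift
        { toFun := Quotient.lift (fun U => (U.faithfulOrbits.ncard : R)) fun _ _ h =>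
            congrArg Nat.cast (BisetSpan.ncard_faithfulOrbits_eq_of_equivalent h)
          map_zero' := by
            change ((BisetSpan.empty K P).faithfulOrbits.ncard : R) = 0
            rw [BisetSpan.faithfulOrbits_eq_empty fun u => PEmpty.elim u, Set.ncard_empty, Nat.cast_zero]
          map_add' := by
            rintro ⟨U⟩ ⟨V⟩
            refine (congrArg Nat.cast (BisetSpan.ncard_faithfulOrbits_disjUnion U V)).trans ?_
            exact Nat.cast_add _ _ }).toIntLinearMap) : R ⊗[ℤ] BurnsideGroup K P →ₗ[R] R)

theorem faithfulCount_ofSpan {K : FracObj.{u} R} (U : BisetSpan K P) :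
    faithfulCount 𝕜 K P (ofSpan U) = U.faithfulOrbits.ncard := by
  -- `ofSpan U` is 1 ⊗ [U], so the value of `faithfulCount` unfolds to the left-hand side, with f
  -- the counting map.
  have h : ∀ f : SpanClass K P →+ R, (LinearMap.toSpanSingleton R 𝕜 1)
      ((1 : R) • BurnsideGroup.lift f (BurnsideGroup.mk U)) =
        algebraMap R 𝕜 (f (SpanClass.mk U)) := fun f => by
    rw [BurnsideGroup.lift_mk, one_smul, LinearMap.toSpanSingleton_apply, Algebra.smul_def, mul_one]
  exact (h _).trans (map_natCast (algebraMap R 𝕜) _)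

/-- The counting form lies in this space and takes the value 1 on the identity, which is nonzero in
every characteristic. -/
theorem faithfulForms_ne_bot (K : FracObj.{u} R) [Unique K.pts] : faithfulForms 𝕜 K K ≠ ⊥ := by
  intro h
  have h1 : faithfulCount 𝕜 K K ∈ faithfulForms 𝕜 K K := fun U hU => by
    rw [faithfulCount_ofSpan, BisetSpan.faithfulOrbits_eq_empty hU, Set.ncard_empty, Nat.cast_zero]
  rw [h, Submodule.mem_bot] at h1
  have h2 := faithfulCount_ofSpan 𝕜 (BisetSpan.idSpan K)
  rw [h1, BisetSpan.ncard_faithfulOrbits_idSpan, Nat.cast_one] at h2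
  exact zero_ne_one h2

end Functionals

end FracObj

/-! ### Multisets and triangular matrices -/

/-- Two finite multisets are equal if they are not separated by the sums of the rows of a matrix
which is triangular, with nonzero diagonal entries, with respect to a size function. -/
theorem Multiset.eq_of_triangular {β : Type*} (size : β → ℕ) (d : β → β → ℕ)
    (hd : ∀ x, d x x ≠ 0) (htri : ∀ x y, size y ≤ size x → d x y ≠ 0 → x = y)
    (s t : Multiset β) (h : ∀ x, (s.map (d x)).sum = (t.map (d x)).sum) : s = t := by
  classical
  -- If no element of t is larger than x ∈ s, only copies of x in t contribute to row x over t. The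
  -- row sum over s is nonzero because of `d x x`, so such a copy exists.
  have hstep : ∀ (s t : Multiset β), (∀ x, (s.map (d x)).sum = (t.map (d x)).sum) →
      ∀ x ∈ s, (∀ y ∈ t, size y ≤ size x) → x ∈ t := fun s t h x hx hy => by
    by_contra hxt
    have h1 : (t.map (d x)).sum = 0 := Multiset.sum_eq_zero fun n hn => by
      obtain ⟨y, hyt, rfl⟩ := Multiset.mem_map.1 hn
      by_contra hne
      exact hxt (htri x y (hy y hyt) hne ▸ hyt)
    rw [← h x] at h1
    exact hd x (Multiset.sum_eq_zero_iff.1 h1 _ (Multiset.mem_map_of_mem _ hx))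
  induction hn : s.card using Nat.strong_induction_on generalizing s t with
  | _ n ih =>
    by_cases hst : s + t = 0
    · rw [(add_eq_zero.1 hst).1, (add_eq_zero.1 hst).2]
    -- An element of maximal size in the union lies in both multisets; removing it from each
    -- preserves equality of the row sums, and the cardinality drops.
    · obtain ⟨x, hx, hmax⟩ := (s + t).toFinset.exists_max_image size
        (by rwa [Multiset.toFinset_nonempty])
      simp only [Multiset.mem_toFinset, Multiset.mem_add] at hx hmax
      have hmem : x ∈ s ∧ x ∈ t := by
        rcases hx with hx | hx
        · exact ⟨hx, hstep s t h x hx fun y hy => hmax y (Or.inr hy)⟩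
        · exact ⟨hstep t s (fun x => (h x).symm) x hx fun y hy => hmax y (Or.inl hy), hx⟩
      obtain ⟨s', rfl⟩ := Multiset.exists_cons_of_mem hmem.1
      obtain ⟨t', rfl⟩ := Multiset.exists_cons_of_mem hmem.2
      rw [ih s'.card (by rw [← hn, Multiset.card_cons]; exact Nat.lt_succ_self _) s' t'
        (fun y => by simpa using h y) rfl]

/-- Finite families with the same multiset of values agree up to reindexing. -/
theorem exists_equiv_of_map_univ_eq {ι κ β : Type*} [Fintype ι] [Fintype κ] {f : ι → β} {g : κ → β}
    (h : Finset.univ.val.map f = Finset.univ.val.map g) : ∃ σ : ι ≃ κ, ∀ i, g (σ i) = f i := by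
  classical
  -- The multiplicity of c in each multiset is the size of the fibre over c, so the fibres can be
  -- matched one by one.
  have key : ∀ c, Nonempty ({i // f i = c} ≃ {j // g j = c}) := fun c => by
    refine ⟨Fintype.equivOfCardEq ?_⟩
    have := congrArg (Multiset.count c) h
    rw [Multiset.count_map, Multiset.count_map] at this
    rw [Fintype.card_subtype, Fintype.card_subtype]
    simpa [Finset.card, eq_comm] using this
  exact ⟨Equiv.ofFiberEquiv fun c => (key c).some, Equiv.ofFiberEquiv_map _⟩

/-! ### Finite direct sums in a preadditive category -/

/-- A presentation of an object of a preadditive category as a finite direct sum. -/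
structure DirectSumDecomposition {C : Type*} [Category C] [Preadditive C] (X : C)
    {I : Type*} [Fintype I] (A : I → C) where
  ι (i : I) : A i ⟶ X
  π (i : I) : X ⟶ A i
  ι_π_self (i : I) : ι i ≫ π i = 𝟙 (A i)
  ι_π_ne {i j : I} (h : i ≠ j) : ι i ≫ π j = 0
  total : ∑ i, π i ≫ ι i = 𝟙 X

namespace DirectSumDecomposition

variable {C : Type*} [Category C] [Preadditive C] {X Y : C} {I J : Type*} [Fintype I] [Fintype J]
  {A : I → C} {B : J → C}

/-- Transport of a decomposition along an isomorphism. -/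
def ofIso (D : DirectSumDecomposition X A) (e : X ≅ Y) : DirectSumDecomposition Y A where
  ι i := D.ι i ≫ e.hom
  π i := e.inv ≫ D.π i
  ι_π_self i := by simp [D.ι_π_self]
  ι_π_ne h := by simp [D.ι_π_ne h]
  total := by
    have : ∀ i, (e.inv ≫ D.π i) ≫ D.ι i ≫ e.hom = e.inv ≫ (D.π i ≫ D.ι i) ≫ e.hom := by simp
    simp_rw [this, ← Preadditive.comp_sum, ← Preadditive.sum_comp, D.total]
    simp

/-- The decomposition of a biproduct. -/
noncomputable def biproduct {I : Type} [Fintype I] (A : I → C) [HasBiproduct A] : DirectSumDecomposition (⨁ A) A where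
  ι := biproduct.ι A
  π := biproduct.π A
  ι_π_self := biproduct.ι_π_self A
  ι_π_ne h := biproduct.ι_π_ne A h
  total := biproduct.total

/-- An object with a decomposition is isomorphic to the biproduct. -/
noncomputable def isoBiproduct {I : Type} [Fintype I] {A : I → C} [HasBiproduct A]
    (D : DirectSumDecomposition X A) : X ≅ ⨁ A where
  hom := biproduct.lift D.π
  inv := biproduct.desc D.ι
  hom_inv_id := by rw [biproduct.lift_desc, D.total]
  inv_hom_id := by
    classical
    refine biproduct.hom_ext' _ _ fun i => biproduct.hom_ext _ _ fun j => ?_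
    by_cases h : i = j
    · subst h
      simp [D.ι_π_self]
    · simp [D.ι_π_ne h, biproduct.ι_π_ne _ h]

/-- The decomposition of an isomorphic object with a single summand. -/
def single (e : X ≅ Y) : DirectSumDecomposition X (fun _ : Unit => Y) where
  ι _ := e.inv
  π _ := e.hom
  ι_π_self _ := e.inv_hom_id
  ι_π_ne h := absurd rfl h
  total := by simp

/-- Decompositions of the two summands of a binary biproduct. -/
noncomputable def biprod [HasBinaryBiproduct X Y] (D : DirectSumDecomposition X A)
    (E : DirectSumDecomposition Y B) : DirectSumDecomposition (X ⊞ Y) (Sum.elim A B) where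
  ι := Sum.rec (fun i => D.ι i ≫ biprod.inl) (fun j => E.ι j ≫ biprod.inr)
  π := Sum.rec (fun i => biprod.fst ≫ D.π i) (fun j => biprod.snd ≫ E.π j)
  ι_π_self := by
    rintro (i | j)
    · simp [D.ι_π_self]
    · simp [E.ι_π_self]
  ι_π_ne := by
    rintro (i | i) (j | j) h
    · have h' : i ≠ j := fun e => h (congrArg Sum.inl e)
      exact show (D.ι i ≫ biprod.inl) ≫ biprod.fst ≫ D.π j = 0 by simp [D.ι_π_ne h']
    · exact show (D.ι i ≫ biprod.inl) ≫ biprod.snd ≫ E.π j = 0 by simp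
    · exact show (E.ι i ≫ biprod.inr) ≫ biprod.fst ≫ D.π j = 0 by simp
    · have h' : i ≠ j := fun e => h (congrArg Sum.inr e)
      exact show (E.ι i ≫ biprod.inr) ≫ biprod.snd ≫ E.π j = 0 by simp [E.ι_π_ne h']
  total := by
    have h1 : ∀ i, ((biprod.fst : X ⊞ Y ⟶ X) ≫ D.π i) ≫ D.ι i ≫ (biprod.inl : X ⟶ X ⊞ Y) =
      biprod.fst ≫ (D.π i ≫ D.ι i) ≫ biprod.inl := by simp
    have h2 : ∀ i, ((biprod.snd : X ⊞ Y ⟶ Y) ≫ E.π i) ≫ E.ι i ≫ (biprod.inr : Y ⟶ X ⊞ Y) =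
      biprod.snd ≫ (E.π i ≫ E.ι i) ≫ biprod.inr := by simp
    refine (Fintype.sum_sum_type _).trans ?_
    change ∑ i, ((biprod.fst : X ⊞ Y ⟶ X) ≫ D.π i) ≫ D.ι i ≫ (biprod.inl : X ⟶ X ⊞ Y) +
      ∑ j, ((biprod.snd : X ⊞ Y ⟶ Y) ≫ E.π j) ≫ E.ι j ≫ (biprod.inr : Y ⟶ X ⊞ Y) = _
    simp_rw [h1, h2, ← Preadditive.comp_sum, ← Preadditive.sum_comp, D.total, E.total,
      Category.id_comp, biprod.total]

theorem isZero_of_isEmpty (D : DirectSumDecomposition X A) [IsEmpty I] : IsZero X := by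
  rw [IsZero.iff_id_eq_zero, ← D.total, Finset.univ_eq_empty, Finset.sum_empty]

end DirectSumDecomposition

/-! ### The rank invariant -/

namespace FracObj

variable {R : Type v} [CommRing R] {P Q : FracObj.{u} R}

section Rank

variable (𝕜 : Type*) [Field 𝕜] [Algebra R 𝕜]

/-- The dimension of the space of linear forms on the morphisms from `K` which vanish on the spans
without faithful points. -/
noncomputable def faithfulRank (K P : FracObj.{u} R) : ℕ := Module.finrank 𝕜 (faithfulForms 𝕜 K P)

/-- An additive contravariant functor carries the relations between the ι and the π to the same
relations with the order reversed, so the induced maps f and g are mutually inverse. -/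
theorem faithfulRank_eq_sum (K : FracObj.{u} R) {ι : Type*} [Fintype ι] {A : ι → FracObj.{u} R}
    (D : DirectSumDecomposition P A) :
    faithfulRank 𝕜 K P = ∑ i, faithfulRank 𝕜 K (A i) := by
  classical
  let f : faithfulForms 𝕜 K P →ₗ[𝕜] ∀ i, faithfulForms 𝕜 K (A i) :=
    LinearMap.pi fun i => faithfulFormsMap 𝕜 K (D.ι i)
  let g : (∀ i, faithfulForms 𝕜 K (A i)) →ₗ[𝕜] faithfulForms 𝕜 K P :=
    ∑ i, (faithfulFormsMap 𝕜 K (D.π i)).comp (LinearMap.proj i)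
  have hg : ∀ ψ, g ψ = ∑ i, faithfulFormsMap 𝕜 K (D.π i) (ψ i) := fun ψ => by
    simp [g]
  have hfg : f.comp g = LinearMap.id := by
    refine LinearMap.ext fun ψ => funext fun i => ?_
    change faithfulFormsMap 𝕜 K (D.ι i) (g ψ) = ψ i
    rw [hg, map_sum, Finset.sum_eq_single i]
    · rw [← LinearMap.comp_apply, ← faithfulFormsMap_comp, D.ι_π_self, faithfulFormsMap_id,
        LinearMap.id_apply]
    · intro j _ hj
      rw [← LinearMap.comp_apply, ← faithfulFormsMap_comp, D.ι_π_ne hj.symm]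
      exact DFunLike.congr_fun (map_zero (faithfulFormsMapHom 𝕜 K (A i) (A j))) (ψ j)
    · simp
  have hgf : g.comp f = LinearMap.id := by
    have h : g.comp f = faithfulFormsMapHom 𝕜 K P P (∑ i, D.π i ≫ D.ι i) := by
      rw [map_sum]
      refine LinearMap.ext fun φ => ?_
      rw [LinearMap.comp_apply, hg, LinearMap.sum_apply]
      exact Finset.sum_congr rfl fun i _ =>
        (DFunLike.congr_fun (faithfulFormsMap_comp 𝕜 K (D.π i) (D.ι i)) φ).symm
    rw [h, D.total]
    exact faithfulFormsMap_id 𝕜 K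
  have : ∀ i, Module.Free 𝕜 (faithfulForms 𝕜 K (A i)) :=
    fun i => Module.Free.of_divisionRing 𝕜 (faithfulForms 𝕜 K (A i))
  rw [faithfulRank, (LinearEquiv.ofLinearMap f g hfg hgf).finrank_eq, Module.finrank_pi_fintype]
  rfl

theorem faithfulRank_congr (K : FracObj.{u} R) (e : P ≅ Q) :
    faithfulRank 𝕜 K P = faithfulRank 𝕜 K Q := by
  rw [faithfulRank_eq_sum 𝕜 K (DirectSumDecomposition.single e)]
  simp

theorem faithfulRank_self_ne_zero (K : FracObj.{u} R) [Unique K.pts] : faithfulRank 𝕜 K K ≠ 0 :=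
  fun h => faithfulForms_ne_bot 𝕜 K (Submodule.finrank_eq_zero.1 h)

/-- This is the triangularity: without an isomorphism, and with P no larger than K, no span from K
to P has a faithful point, so every form in the space vanishes on all spans. -/
theorem nonempty_mulEquiv_of_faithfulRank_ne_zero {K : FracObj.{u} R}
    (h : faithfulRank 𝕜 K P ≠ 0) (hle : Nat.card P.grp ≤ Nat.card K.grp) :
    Nonempty (K.grp ≃* P.grp) := by
  by_contra hne
  refine h ?_
  rw [faithfulRank, faithfulForms_eq_bot 𝕜 fun U u hu => hne (hu.nonempty_mulEquiv hle)]
  exact finrank_bot 𝕜 _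

end Rank

end FracObj

/-! ### Orbits as direct summands -/

namespace FracObj

variable {R : Type v} {P Q : FracObj.{u} R}

/-- The span from a one-point object to `X / G` given by a group homomorphism to the stabilizer of a
point `x`: the group `G` with `(a, s) g = a g φ(s)⁻¹` and the map `g ↦ g x`. -/
def pointSpan [Unique Q.pts] (φ : Q.grp →* P.grp) (x : P.pts) (hx : ∀ s, φ s • x = x) :
    BisetSpan Q P where
  carrier := P.grp
  action :=
    { smul := fun a g => a.1 * g * (φ a.2)⁻¹
      one_smul := fun g => by
        change 1 * g * (φ 1)⁻¹ = g
        simp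
      mul_smul := fun a b g => by
        change (a.1 * b.1) * g * (φ (a.2 * b.2))⁻¹ = a.1 * (b.1 * g * (φ b.2)⁻¹) * (φ a.2)⁻¹
        simp [mul_assoc] }
  left g := g • x
  right _ := default
  left_smul a g := by
    change (a.1 * g * (φ a.2)⁻¹) • x = a.1 • g • x
    rw [mul_smul, mul_smul, inv_smul_eq_iff.2 (hx a.2).symm]
  right_smul _ _ := Subsingleton.elim _ _

section

variable [Unique Q.pts] {φ : Q.grp →* P.grp} {x : P.pts}

/-- Points of the pullback are pairs (g, g') with g x = g' x. Modulo left translation such a pair is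
the element g⁻¹g' of the stabilizer of x, which φ identifies with `Q.grp`. -/
theorem opSpan_comp_pointSpan (hφ : Function.Injective φ)
    (hst : ∀ g, g • x = x ↔ ∃ s, φ s = g) :
    BisetSpan.Equivalent
      (BisetSpan.comp (opSpan (pointSpan φ x fun s => (hst _).2 ⟨s, rfl⟩))
        (pointSpan φ x fun s => (hst _).2 ⟨s, rfl⟩)) (BisetSpan.idSpan Q) := by
  have h : ∀ g, ∃ s, g • x = x → φ s = g := fun g => by
    by_cases hg : g • x = x
    · obtain ⟨s, hs⟩ := (hst g).1 hg
      exact ⟨s, fun _ => hs⟩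
    · exact ⟨1, fun h => absurd h hg⟩
  choose r hr using h
  have hr' : ∀ g g' : P.grp, g • x = g' • x → φ (r (g⁻¹ * g')) = g⁻¹ * g' := fun g g' h =>
    hr _ (by rw [mul_smul, inv_smul_eq_iff, h])
  refine BisetSpan.comp_equivalent
    (fun w => (r ((show P.grp from w.1.1)⁻¹ * (show P.grp from w.1.2)), default))
    (fun z => ⟨((1 : P.grp), φ z.1), ?_⟩) ?_ ?_ ?_ ?_ ?_ ?_
  · change (1 : P.grp) • x = φ z.1 • x
    rw [one_smul, (hst _).2 ⟨_, rfl⟩]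
  · rintro a ⟨⟨(g : P.grp), (g' : P.grp)⟩, (hw : g • x = g' • x)⟩
    refine Prod.ext ?_ rfl
    change r ((a * g * (φ 1)⁻¹)⁻¹ * (a * g' * (φ 1)⁻¹)) = r (g⁻¹ * g')
    rw [map_one]
    congr 1
    group
  · rintro ⟨g, y⟩
    refine Prod.ext (hφ ?_) (Subsingleton.elim _ _)
    change φ (r ((1 : P.grp)⁻¹ * φ g)) = φ g
    rw [inv_one, one_mul]
    exact hr _ ((hst _).2 ⟨_, rfl⟩)
  · rintro ⟨⟨(g : P.grp), (g' : P.grp)⟩, (hw : g • x = g' • x)⟩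
    refine ⟨g⁻¹, BisetSpan.Pullback.ext ?_ ?_⟩
    · change g⁻¹ * g * (φ 1)⁻¹ = 1
      simp
    · change g⁻¹ * g' * (φ 1)⁻¹ = φ (r (g⁻¹ * g'))
      rw [hr' _ _ hw]
      simp
  · rintro ⟨a, b⟩ ⟨⟨(g : P.grp), (g' : P.grp)⟩, (hw : g • x = g' • x)⟩
    refine Prod.ext (hφ ?_) (Subsingleton.elim _ _)
    change φ (r ((1 * g * (φ a)⁻¹)⁻¹ * (1 * g' * (φ b)⁻¹))) = φ (a * r (g⁻¹ * g') * b⁻¹)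
    have hs : ∀ s, (φ s)⁻¹ • x = x := fun s => inv_smul_eq_iff.2 ((hst _).2 ⟨s, rfl⟩).symm
    rw [map_mul, map_mul, map_inv, hr' _ _ hw, hr']
    · group
    · simp only [mul_smul, hs, hw]
  · exact fun _ => Subsingleton.elim _ _
  · exact fun _ => Subsingleton.elim _ _

/-- Over the one-point set the pullback is all of G × G, and φ acts on both factors by right
translation. The pair (g g'⁻¹, g x) determines (g, g') up to the stabilizer of x, and it ranges over
the part of the identity span above the orbit of x. -/
theorem pointSpan_comp_opSpan {I : Type*} (c : (BisetSpan.idSpan P).carrier → I)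
    (hc : ∀ (a : P.grp × P.grp) u, c (a • u) = c u) (i : I)
    (hst : ∀ g, g • x = x ↔ ∃ s, φ s = g)
    (hci : ∀ z : P.grp × P.pts, c z = i ↔ ∃ g : P.grp, g • x = z.2) :
    BisetSpan.Equivalent
      (BisetSpan.comp (pointSpan φ x fun s => (hst _).2 ⟨s, rfl⟩)
        (opSpan (pointSpan φ x fun s => (hst _).2 ⟨s, rfl⟩)))
      (BisetSpan.restrict (BisetSpan.idSpan P) c hc {i}) := by
  set U := pointSpan φ x fun s => (hst _).2 ⟨s, rfl⟩
  have h : ∀ z : (BisetSpan.restrict (BisetSpan.idSpan P) c hc {i}).carrier,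
      ∃ g : P.grp, g • x = z.1.2 := fun z => (hci _).1 z.2
  choose t ht using h
  refine BisetSpan.comp_equivalent
    (fun w => ⟨((show P.grp from w.1.1) * (show P.grp from w.1.2)⁻¹,
      (show P.grp from w.1.1) • x), (hci _).2 ⟨_, rfl⟩⟩)
    (fun z => ⟨(t z, z.1.1⁻¹ * t z), rfl⟩) ?_ ?_ ?_ ?_ ?_ ?_
  · rintro a ⟨⟨(g : P.grp), (g' : P.grp)⟩, hw⟩
    refine Subtype.ext (Prod.ext ?_ ?_)
    · change (1 * g * (φ a)⁻¹) * (1 * g' * (φ a)⁻¹)⁻¹ =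
        g * g'⁻¹
      group
    · exact (U.left_smul (1, a) g).trans (one_smul P.grp _)
  · intro z
    refine Subtype.ext (Prod.ext ?_ (ht z))
    change t z * (z.1.1⁻¹ * t z)⁻¹ = z.1.1
    group
  · rintro ⟨⟨(g : P.grp), (g' : P.grp)⟩, hw⟩
    set z : (BisetSpan.restrict (BisetSpan.idSpan P) c hc {i}).carrier :=
      ⟨(g * g'⁻¹, g • x),
        (hci _).2 ⟨_, rfl⟩⟩
    -- Both g and the chosen `t z` carry x to g x, so they differ by an element of the stabilizer;
    -- its preimage under φ links the two representatives.
    obtain ⟨s, hs⟩ := (hst ((t z)⁻¹ * g)).1 (by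
      rw [mul_smul, inv_smul_eq_iff, ht z])
    refine ⟨s, BisetSpan.Pullback.ext ?_ ?_⟩
    · change 1 * g * (φ s)⁻¹ = t z
      rw [hs]
      group
    · change 1 * g' * (φ s)⁻¹ =
        (g * g'⁻¹)⁻¹ * t z
      rw [hs]
      group
  · rintro ⟨a, b⟩ ⟨⟨(g : P.grp), (g' : P.grp)⟩, hw⟩
    refine Subtype.ext (Prod.ext ?_ ?_)
    · change (a * g * (φ 1)⁻¹) * (b * g' * (φ 1)⁻¹)⁻¹ =
        a * (g * g'⁻¹) * b⁻¹
      rw [map_one]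
      group
    · exact U.left_smul (a, 1) g
  · exact fun _ => rfl
  · rintro ⟨⟨(g : P.grp), (g' : P.grp)⟩, hw⟩
    change (g * g'⁻¹)⁻¹ • g • x =
      g' • x
    rw [smul_smul]
    congr 1
    group

end

variable [CommRing R]

/-- The decomposition of `X / G` into one-point objects given by the stabilizers of representatives
of the orbits. -/
noncomputable def orbitDecomposition {I : Type*} [Fintype I] (A : I → FracObj.{u} R)
    [∀ i, Unique (A i).pts] (x : I → P.pts)
    (hx : ∀ y, ∃! i, y ∈ MulAction.orbit P.grp (x i)) (φ : ∀ i, (A i).grp →* P.grp)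
    (hφ : ∀ i, Function.Injective (φ i)) (hst : ∀ i g, g • x i = x i ↔ ∃ s, φ i s = g) :
    DirectSumDecomposition P A where
  ι i := ofSpan (pointSpan (φ i) (x i) fun s => (hst i _).2 ⟨s, rfl⟩)
  π i := ofSpan (opSpan (pointSpan (φ i) (x i) fun s => (hst i _).2 ⟨s, rfl⟩))
  ι_π_self i := by
    rw [ofSpan_comp, ← ofSpan_id]
    exact ofSpan_eq (opSpan_comp_pointSpan (hφ i) (hst i))
  ι_π_ne {i j} h := by
    rw [ofSpan_comp]
    refine ofSpan_eq_zero ⟨?_⟩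
    rintro ⟨⟨⟨(g : P.grp), (g' : P.grp)⟩, (hw : g • x j = g' • x i)⟩⟩
    -- A point of the pullback would be a common element of the orbits of `x i` and `x j`.
    exact h ((hx (g • x j)).unique ⟨_, hw.symm⟩ ⟨_, rfl⟩)
  total := by
    -- The colour of (g, y) in the identity span is the index of the orbit of y.
    have hc : ∀ (a : P.grp × P.grp) (z : (BisetSpan.idSpan P).carrier),
        (hx (a • z).2).choose = (hx z.2).choose := fun a z =>
      (hx z.2).unique ((MulAction.orbitRel P.grp P.pts).trans ⟨a.1⁻¹, inv_smul_smul a.1 z.2⟩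
        (hx (a • z).2).choose_spec.1) (hx z.2).choose_spec.1
    rw [← ofSpan_id, ofSpan_eq_sum_restrict _ (fun z : P.grp × P.pts => (hx z.2).choose) hc]
    refine Finset.sum_congr rfl fun i _ => ?_
    rw [ofSpan_comp]
    refine ofSpan_eq (pointSpan_comp_opSpan _ hc i (hst i) fun z => ⟨?_, fun h => ?_⟩)
    · rintro rfl
      exact (hx z.2).choose_spec.1
    · exact (hx z.2).unique (hx z.2).choose_spec.1 h

/-- One-point objects with isomorphic groups are isomorphic. -/
theorem nonempty_iso_of_mulEquiv [Unique P.pts] [Unique Q.pts] (e : Q.grp ≃* P.grp) :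
    Nonempty (P ≅ Q) := by
  let D : DirectSumDecomposition P (fun _ : Unit => Q) := orbitDecomposition (fun _ => Q)
    (fun _ => default) (fun _ => ⟨(), ⟨1, Subsingleton.elim _ _⟩, fun _ _ => rfl⟩)
    (fun _ => e.toMonoidHom) (fun _ => e.injective)
    (fun _ g => ⟨fun _ => e.surjective g, fun _ => Subsingleton.elim _ _⟩)
  exact ⟨⟨D.π (), D.ι (), by simpa using D.total, D.ι_π_self ()⟩⟩

/-- Every object is a finite direct sum of objects `{•} / G`. -/
theorem exists_decomposition (P : FracObj.{u} R) :
    ∃ (n : ℕ) (A : Fin n → FracObj.{u} R), (∀ i, Nonempty (Unique (A i).pts)) ∧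
      Nonempty (DirectSumDecomposition P A) := by
  have : Finite (MulAction.orbitRel.Quotient P.grp P.pts) := Quotient.finite _
  let e := Finite.equivFin (MulAction.orbitRel.Quotient P.grp P.pts)
  let x : Fin _ → P.pts := fun i => (e.symm i).out
  refine ⟨_, fun i => pt R (MulAction.stabilizer P.grp (x i)), fun _ => ⟨inferInstance⟩,
    ⟨orbitDecomposition _ x (fun y => ?_) (fun i => Subgroup.subtype _)
      (fun i => Subtype.val_injective) (fun i g => ⟨fun h => ⟨⟨g, h⟩, rfl⟩, ?_⟩)⟩⟩
  · have h : ∀ i, y ∈ MulAction.orbit P.grp (x i) ↔ e (Quotient.mk _ y) = i := fun i => by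
      rw [← Equiv.eq_symm_apply]
      conv_rhs => rw [← Quotient.out_eq (e.symm i)]
      exact (Quotient.eq (r := MulAction.orbitRel P.grp P.pts)).symm
    simp only [h]
    exact ⟨_, rfl, fun _ => Eq.symm⟩
  · rintro ⟨s, rfl⟩
    exact s.2

/-- Decompositions into one-point objects are unique. -/
theorem decomposition_unique [Nontrivial R] {I J : Type*} [Fintype I] [Fintype J]
    {A : I → FracObj.{u} R} {B : J → FracObj.{u} R} (hA : ∀ i, Nonempty (Unique (A i).pts))
    (hB : ∀ j, Nonempty (Unique (B j).pts)) (D : DirectSumDecomposition P A)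
    (E : DirectSumDecomposition P B) :
    ∃ σ : I ≃ J, ∀ i, Nonempty ((A i).grp ≃* (B (σ i)).grp) := by
  -- The nonzero ring R has a residue field, over which the ranks are taken.
  obtain ⟨m, hm⟩ := Ideal.exists_maximal R
  let _ : Field (R ⧸ m) := Ideal.Quotient.field m
  let T := {K : FracObj.{u} R // Nonempty (Unique K.pts)}
  let s : Setoid T :=
    { r := fun K L => Nonempty (K.1.grp ≃* L.1.grp)
      iseqv := ⟨fun _ => ⟨MulEquiv.refl _⟩, fun ⟨e⟩ => ⟨e.symm⟩, fun ⟨e⟩ ⟨f⟩ => ⟨e.trans f⟩⟩ }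
  let size : Quotient s → ℕ := fun q => Nat.card q.out.1.grp
  let d : Quotient s → Quotient s → ℕ := fun p q => faithfulRank (R ⧸ m) p.out.1 q.out.1
  -- The matrix is indexed by isomorphism types of groups and read off on chosen representatives.
  -- One-point objects with isomorphic groups are isomorphic, so the second argument may be any
  -- representative.
  have hd : ∀ (p : Quotient s) (K : T),
      d p (Quotient.mk s K) = faithfulRank (R ⧸ m) p.out.1 K.1 := fun p K => by
    obtain ⟨e⟩ : s (Quotient.mk s K).out K := Quotient.mk_out K
    have := (Quotient.mk s K).out.2.some
    have := K.2.some
    obtain ⟨f⟩ := nonempty_iso_of_mulEquiv (R := R) e.symm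
    exact faithfulRank_congr _ _ f
  let a : I → Quotient s := fun i => Quotient.mk s ⟨A i, hA i⟩
  let b : J → Quotient s := fun j => Quotient.mk s ⟨B j, hB j⟩
  have key : Finset.univ.val.map a = Finset.univ.val.map b := by
    refine Multiset.eq_of_triangular size d (fun p => ?_) (fun p q hle hne => ?_) _ _ fun p => ?_
    · have := p.out.2.some
      exact faithfulRank_self_ne_zero _ _
    · rw [← Quotient.out_eq p, ← Quotient.out_eq q]
      exact Quotient.sound (nonempty_mulEquiv_of_faithfulRank_ne_zero _ hne hle)
    · rw [Multiset.map_map, Multiset.map_map]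
      change ∑ i, d p (a i) = ∑ j, d p (b j)
      simp only [a, b, hd]
      -- Both row sums are the rank of the common object P.
      rw [← faithfulRank_eq_sum _ _ D, ← faithfulRank_eq_sum _ _ E]
  obtain ⟨σ, hσ⟩ := exists_equiv_of_map_univ_eq key
  exact ⟨σ, fun i => Quotient.exact (hσ i).symm⟩

end FracObj

/-! ### The three assertions -/

theorem mainTheorem5 (R : Type v) [CommRing R] [Nontrivial R] :
    -- uniqueness of the decomposition of an object as a direct sum of objects `{•} / G`
    (∀ (n m : ℕ) (G : Fin n → Type u) [∀ i, Group (G i)] [∀ i, Finite (G i)]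
        (H : Fin m → Type u) [∀ j, Group (H j)] [∀ j, Finite (H j)],
        Nonempty ((⨁ fun i => FracObj.pt R (G i)) ≅ ⨁ fun j => FracObj.pt R (H j)) →
          n = m ∧ ∃ σ : Fin n ≃ Fin m, ∀ i, Nonempty (G i ≃* H (σ i))) ∧
    -- the decomposition of `X / G` given by the stabilizers of orbit representatives `x i`
    -- exists, and it is unique up to permutation and isomorphism of groups
    (∀ (G X : Type u) [Group G] [Finite G] [MulAction G X] [Finite X]
        (n : ℕ) (x : Fin n → X), (∀ y : X, ∃! i, y ∈ MulAction.orbit G (x i)) →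
        Nonempty (FracObj.frac R G X ≅ ⨁ fun i => FracObj.pt R (MulAction.stabilizer G (x i))) ∧
        ∀ (m : ℕ) (H : Fin m → Type u) [∀ j, Group (H j)] [∀ j, Finite (H j)],
          Nonempty (FracObj.frac R G X ≅ ⨁ fun j => FracObj.pt R (H j)) →
            n = m ∧ ∃ σ : Fin n ≃ Fin m,
              ∀ i, Nonempty (MulAction.stabilizer G (x i) ≃* H (σ i))) ∧
    -- its summands are indecomposable
    (∀ (G : Type u) [Group G] [Finite G], Indecomposable (FracObj.pt R G)) := by
  have unique : ∀ (n m : ℕ) (G : Fin n → Type u) [∀ i, Group (G i)] [∀ i, Finite (G i)]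
      (H : Fin m → Type u) [∀ j, Group (H j)] [∀ j, Finite (H j)],
      Nonempty ((⨁ fun i => FracObj.pt R (G i)) ≅ ⨁ fun j => FracObj.pt R (H j)) →
        n = m ∧ ∃ σ : Fin n ≃ Fin m, ∀ i, Nonempty (G i ≃* H (σ i)) := by
    rintro n m G _ _ H _ _ ⟨e⟩
    obtain ⟨σ, hσ⟩ := FracObj.decomposition_unique (fun _ => ⟨inferInstance⟩)
      (fun _ => ⟨inferInstance⟩) ((DirectSumDecomposition.biproduct _).ofIso e)
      (DirectSumDecomposition.biproduct fun j => FracObj.pt R (H j))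
    exact ⟨by simpa using Fintype.card_congr σ, σ, hσ⟩
  refine ⟨unique, ?_, ?_⟩
  · intro G X _ _ _ _ n x hx
    have D : DirectSumDecomposition (FracObj.frac R G X)
        fun i => FracObj.pt R (MulAction.stabilizer G (x i)) :=
      FracObj.orbitDecomposition _ x hx (fun i => Subgroup.subtype _)
        (fun i => Subtype.val_injective)
        (fun i g => ⟨fun h => ⟨⟨g, h⟩, rfl⟩, by rintro ⟨s, rfl⟩; exact s.2⟩)
    refine ⟨⟨D.isoBiproduct⟩, ?_⟩
    rintro m H _ _ ⟨e⟩
    exact unique n m _ H ⟨D.isoBiproduct.symm ≪≫ e⟩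
  · intro G _ _
    have D := DirectSumDecomposition.single (Iso.refl (FracObj.pt R G))
    -- Comparison with the decomposition of {•}/G into itself alone: every decomposition into
    -- one-point objects has exactly one term.
    have card : ∀ {J : Type} [Fintype J] {B : J → FracObj.{u} R},
        (∀ j, Nonempty (Unique (B j).pts)) →
        DirectSumDecomposition (FracObj.pt R G) B → Fintype.card J = 1 := fun hB E => by
      obtain ⟨σ, -⟩ := FracObj.decomposition_unique (fun _ => ⟨inferInstance⟩) hB D E
      rw [← Fintype.card_congr σ, Fintype.card_unit]
    refine ⟨fun h => ?_, fun Y Z e => ?_⟩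
    -- If {•}/G were zero, it would be the empty direct sum, with 0 terms instead of 1.
    · have E : DirectSumDecomposition (FracObj.pt R G) (Empty.elim : Empty → FracObj.{u} R) :=
        { ι := fun i => i.elim
          π := fun i => i.elim
          ι_π_self := fun i => i.elim
          ι_π_ne := fun {i} => i.elim
          total := h.eq_of_src _ _ }
      exact absurd (card (fun j => j.elim) E) (by simp)
    · obtain ⟨n, A, hA, ⟨EA⟩⟩ := FracObj.exists_decomposition Y
      obtain ⟨m, B, hB, ⟨EB⟩⟩ := FracObj.exists_decomposition Z
      have h := card (Sum.rec hA hB) ((EA.biprod EB).ofIso e.symm)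
      rw [Fintype.card_sum, Fintype.card_fin, Fintype.card_fin] at h
      -- From n + m = 1, one of Y and Z is an empty direct sum.
      obtain rfl | rfl : n = 0 ∨ m = 0 := by omega
      · exact Or.inl EA.isZero_of_isEmpty
      · exact Or.inr EB.isZero_of_isEmpty
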